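/- Let $P=\{p_1,\dots,p_d\}$ be a finite poset and let $G$ be a perfect graph on $[d]=\{1,\dots,d\}$; identify $p_i$ with $i$. Let $K$ be a field, let $\mathcal J(P)$ be the set of poset ideals (down-closed subsets, including $\emptyset$ and $P$) of $P$, and let $S(G)$ be the set of stable (independent) sets of $G$, including $\emptyset$. For $X\subseteq[d]$ put $\rho(X)=\sum_{i\in X}\mathbf e_i$. Let $\mathcal O_P=\mathrm{conv}\{\rho(I): I\in\mathcal J(P)\}$ and $\mathcal Q_G=\mathrm{conv}\{\rho(S): S\in S(G)\}$, both in $\mathbb R^d$, and let $\mathcal O_P*\mathcal Q_G=\mathrm{conv}\big((\mathcal O_P\times\{1\})\cup(\mathcal Q_G\times\{0\})\big)\subset\mathbb R^{d+1}$. The lattice points of $\mathcal O_P*\mathcal Q_G$ are the points $(\rho(I),1)$ for $I\in\mathcal J(P)$ and $(\rho(S),0)$ for $S\in S(G)$. Write $x_I$ and $y_S$ for the corresponding variables, and $z=y_\emptyset$. Let $\mathcal R=K[\{x_I\}_{I\in\mathcal J(P)}\cup\{y_S\}_{\emptyset\ne S\in S(G)}\cup\{z\}]$. The toric ideal $I_{\mathcal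 O_P*\mathcal Q_G}\subset\mathcal R$ is the kernel of the $K$-algebra homomorphism $\mathcal R\to K[t_1^{\pm1},\dots,t_{d+1}^{\pm1},s]$ with $x_I\mapsto \mathbf t^{\rho(I)}t_{d+1}s$, $y_S\mapsto\mathbf t^{\rho(S)}s$, $z\mapsto s$. The toric ideal $I_{\mathcal Q_G}$ is the kernel of the restriction of this map to $K[\{y_S\}_{\emptyset\ne S\in S(G)}\cup\{z\}]$. Let $<$ be the (graded) reverse lexicographic order on $\mathcal R$ induced by any total ordering of the variables such that - $z<y_S<x_I$ for all $\emptyset\neq S\in S(G)$ and $I\in\mathcal J(P)$; - $x_{I'}<x_I$ for all $I,I'\in\mathcal J(P)$ with $I'\supsetneq I$; - $y_{S'}<y_S$ for all $S,S'\in S(G)\setminus\{\emptyset\}$ with $S'\subsetneq S$. Let $$\mathcal G_P=\{x_Ix_{I'}-x_{I\cap I'}x_{I\cup I'} : I,I'\in\mathcal J(P),\ I\not\subseteq I',\ I'\not\subseteq I\},$$ $$\mathcal G=\{x_Iy_S-x_{I\cup\{s\}}y_{S\setminus\{s\}} : I\in\mathcal J(P),\ S\in S(G),\ s\in S\setminus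 I,\ I\cup\{s\}\in\mathcal J(P)\},$$ and let $\mathcal G_G$ be the reduced Gröbner basis (which exists and is unique) of $I_{\mathcal Q_G}$ with respect to the reverse lexicographic order on $K[\{y_S\}_{\emptyset\ne S\in S(G)}\cup\{z\}]$ induced by the same ordering of variables. Then $\mathcal G_P\cup\mathcal G_G\cup\mathcal G$ is a Gröbner basis of $I_{\mathcal O_P*\mathcal Q_G}$ with respect to $<$: it is a finite set of nonzero elements of the ideal whose initial monomials generate the initial ideal. Moreover, the initial ideal of $I_{\mathcal O_P*\mathcal Q_G}$ with respect to $<$ is squarefree, i.e. generated by squarefree monomials. -/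

import Mathlib

open MvPolynomial

/-! ### The (graded) reverse lexicographic order -/

section RevLex

variable {σ : Type*}

/-- The relation `a < b` of the (graded) reverse lexicographic order on exponent vectors induced by
the ordering `lo` of the variables: `a` has smaller total degree, or the degrees agree and, for the
smallest variable `i` at which `a` and `b` differ, the exponent of `i` is larger in `a`. -/
def revLexLT (lo : LinearOrder σ) (a b : σ →₀ ℕ) : Prop :=
  a.degree < b.degree ∨
    (a.degree = b.degree ∧ ∃ i, (∀ j, lo.lt j i → a j = b j) ∧ b i < a i)

theorem revLexLT_irrefl (lo : LinearOrder σ) (a : σ →₀ ℕ) : ¬ revLexLT lo a a := by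
  rintro (h | ⟨-, i, -, h⟩)
  · exact lt_irrefl _ h
  · exact lt_irrefl _ h

theorem revLexLT_trans (lo : LinearOrder σ) {a b c : σ →₀ ℕ}
    (hab : revLexLT lo a b) (hbc : revLexLT lo b c) : revLexLT lo a c := by
  rcases hab with hab | ⟨hab, i, hi, hi'⟩
  · rcases hbc with hbc | ⟨hbc, -⟩
    · exact Or.inl (hab.trans hbc)
    · exact Or.inl (hbc ▸ hab)
  · rcases hbc with hbc | ⟨hbc, j, hj, hj'⟩
    · exact Or.inl (hab ▸ hbc)
    · refine Or.inr ⟨hab.trans hbc, ?_⟩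
      rcases lt_trichotomy i j with h | h | h
      · exact ⟨i, fun k hk => (hi k hk).trans (hj k (lt_trans hk h)), (hj i h) ▸ hi'⟩
      · subst h
        exact ⟨i, fun k hk => (hi k hk).trans (hj k hk), hj'.trans hi'⟩
      · exact ⟨j, fun k hk => (hi k (lt_trans hk h)).trans (hj k hk), (hi j h).symm ▸ hj'⟩

theorem revLexLT_trichotomous (lo : LinearOrder σ) (a b : σ →₀ ℕ) :
    revLexLT lo a b ∨ a = b ∨ revLexLT lo b a := by
  classical
  by_cases hab : a = b
  · exact Or.inr (Or.inl hab)
  rcases lt_trichotomy a.degree b.degree with h | h | h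
  · exact Or.inl (Or.inl h)
  · have hne : ((a.support ∪ b.support).filter fun i => a i ≠ b i).Nonempty := by
      obtain ⟨i, hi⟩ := Finsupp.ne_iff.1 hab
      refine ⟨i, Finset.mem_filter.2 ⟨?_, hi⟩⟩
      simp only [Finset.mem_union, Finsupp.mem_support_iff]
      by_contra hcon
      push Not at hcon
      exact hi (hcon.1.trans hcon.2.symm)
    obtain ⟨i, hi, hmin⟩ := Finset.exists_minimal hne
    have hi' := (Finset.mem_filter.1 hi).2
    have heq : ∀ j, lo.lt j i → a j = b j := by
      intro j hj
      by_contra hcon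
      have hmem : j ∈ (a.support ∪ b.support).filter fun i => a i ≠ b i := by
        refine Finset.mem_filter.2 ⟨?_, hcon⟩
        simp only [Finset.mem_union, Finsupp.mem_support_iff]
        by_contra hc
        push Not at hc
        exact hcon (hc.1.trans hc.2.symm)
      exact absurd (lt_of_lt_of_le hj (hmin hmem (le_of_lt hj))) (lt_irrefl _)
    rcases lt_or_gt_of_ne hi' with h' | h'
    · exact Or.inr (Or.inr (Or.inr ⟨h.symm, i, fun j hj => (heq j hj).symm, h'⟩))
    · exact Or.inl (Or.inr ⟨h, i, heq, h'⟩)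
  · exact Or.inr (Or.inr (Or.inl h))

theorem revLexLT_add_left_iff (lo : LinearOrder σ) (c a b : σ →₀ ℕ) :
    revLexLT lo (c + a) (c + b) ↔ revLexLT lo a b := by
  simp [revLexLT]

theorem revLexLT_wellFounded [Finite σ] (lo : LinearOrder σ) :
    WellFounded (revLexLT lo) := by
  have hfin : ∀ a : σ →₀ ℕ, {b | revLexLT lo b a}.Finite := by
    intro a
    refine (Set.finite_Iic (Finsupp.equivFunOnFinite.symm fun _ : σ => a.degree)).subset ?_
    intro b hb i
    have h1 : b.degree ≤ a.degree := by
      rcases hb with hb | ⟨hb, -⟩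
      · exact hb.le
      · exact hb.le
    exact (Finsupp.le_degree i b).trans h1
  refine Subrelation.wf (r := InvImage (· < ·) fun a => {b | revLexLT lo b a}.ncard) ?_
    (InvImage.wf _ wellFounded_lt)
  intro b a hba
  refine Set.ncard_lt_ncard ?_ (hfin a)
  refine ⟨fun c hc => revLexLT_trans lo hc hba, fun hsub => ?_⟩
  exact revLexLT_irrefl lo b (hsub hba)

/-- Exponent vectors, carrying the reverse lexicographic order induced by `lo`. -/
def RevLex (_lo : LinearOrder σ) : Type _ := σ →₀ ℕ

noncomputable instance (lo : LinearOrder σ) : AddCommMonoid (RevLex lo) :=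
  inferInstanceAs (AddCommMonoid (σ →₀ ℕ))

noncomputable instance (lo : LinearOrder σ) : LinearOrder (RevLex lo) where
  le a b := a = b ∨ revLexLT lo a b
  lt a b := revLexLT lo a b
  le_refl a := Or.inl rfl
  le_trans a b c := by
    rintro (rfl | h) (rfl | h')
    · exact Or.inl rfl
    · exact Or.inr h'
    · exact Or.inr h
    · exact Or.inr (revLexLT_trans lo h h')
  lt_iff_le_not_ge a b := by
    constructor
    · intro h
      refine ⟨Or.inr h, ?_⟩
      rintro (rfl | h')
      · exact revLexLT_irrefl lo _ h
      · exact revLexLT_irrefl lo _ (revLexLT_trans lo h h')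
    · rintro ⟨rfl | h, h'⟩
      · exact absurd (Or.inl rfl) h'
      · exact h
  le_antisymm a b := by
    rintro (rfl | h) (h' | h')
    · rfl
    · rfl
    · exact h'.symm
    · exact absurd (revLexLT_trans lo h h') (revLexLT_irrefl lo _)
  le_total a b := by
    rcases revLexLT_trichotomous lo a b with h | h | h
    · exact Or.inl (Or.inr h)
    · exact Or.inl (Or.inl h)
    · exact Or.inr (Or.inr h)
  toDecidableLE := Classical.decRel _

theorem RevLex.lt_iff (lo : LinearOrder σ) (a b : RevLex lo) : a < b ↔ revLexLT lo a b := Iff.rfl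

instance [Finite σ] (lo : LinearOrder σ) : WellFoundedLT (RevLex lo) where
  wf := Subrelation.wf (fun {a b} h => (RevLex.lt_iff lo a b).1 h) (revLexLT_wellFounded lo)

instance (lo : LinearOrder σ) : IsOrderedAddMonoid (RevLex lo) where
  add_le_add_left a b h c := by
    rcases h with rfl | h
    · exact le_refl _
    · refine Or.inr ?_
      have h1 : revLexLT lo ((c : σ →₀ ℕ) + a) ((c : σ →₀ ℕ) + b) :=
        (revLexLT_add_left_iff lo c a b).2 h
      have h2 : revLexLT lo ((a : σ →₀ ℕ) + (c : σ →₀ ℕ)) ((b : σ →₀ ℕ) + (c : σ →₀ ℕ)) := by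
        rwa [add_comm (a : σ →₀ ℕ), add_comm (b : σ →₀ ℕ)]
      exact h2

/-- The (graded) reverse lexicographic order induced by the ordering `lo` of the finitely many
variables, as a monomial order. -/
noncomputable def revLexOrder [Finite σ] (lo : LinearOrder σ) : MonomialOrder σ where
  syn := RevLex lo
  toSyn := { toEquiv := Equiv.refl (σ →₀ ℕ), map_add' := fun _ _ => rfl }
  toSyn_monotone a b h := by
    by_cases hab : a = b
    · exact Or.inl hab
    · refine Or.inr (Or.inl ?_)
      obtain ⟨c, rfl⟩ := exists_add_of_le h
      have hc : c ≠ 0 := by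
        rintro rfl
        exact hab (add_zero a).symm
      have : c.degree ≠ 0 := fun h0 => hc ((Finsupp.degree_eq_zero_iff c).1 h0)
      change a.degree < (a + c).degree
      rw [map_add]
      omega

end RevLex

/-! ### Initial ideals and Gröbner bases -/

section Groebner

variable {σ : Type*} {K : Type*} [Field K]

/-- The initial monomial of a (nonzero) polynomial. -/
noncomputable def initialMonomial (m : MonomialOrder σ) (f : MvPolynomial σ K) :
    MvPolynomial σ K :=
  monomial (m.degree f) 1

/-- The initial ideal of `I`: the ideal generated by the initial monomials of the nonzero elements
of `I`. -/
noncomputable def initialIdeal (m : MonomialOrder σ) (I : Ideal (MvPolynomial σ K)) :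
    Ideal (MvPolynomial σ K) :=
  Ideal.span {u | ∃ f ∈ I, f ≠ 0 ∧ u = initialMonomial m f}

/-- `𝒢` is a Gröbner basis of `I`: a finite set of nonzero elements of `I` whose initial monomials
generate the initial ideal of `I`. -/
structure IsGroebnerBasis (m : MonomialOrder σ) (𝒢 : Set (MvPolynomial σ K))
    (I : Ideal (MvPolynomial σ K)) : Prop where
  finite : 𝒢.Finite
  subset : 𝒢 ⊆ I
  ne_zero : ∀ g ∈ 𝒢, g ≠ 0
  span_initial : Ideal.span (initialMonomial m '' 𝒢) = initialIdeal m I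

/-- `𝒢` is a reduced Gröbner basis of `I`: a Gröbner basis whose elements are monic, and such that
no monomial of an element `g` is divisible by the initial monomial of another element `h`. -/
structure IsReducedGroebnerBasis (m : MonomialOrder σ) (𝒢 : Set (MvPolynomial σ K))
    (I : Ideal (MvPolynomial σ K)) : Prop extends IsGroebnerBasis m 𝒢 I where
  monic : ∀ g ∈ 𝒢, m.Monic g
  reduced : ∀ g ∈ 𝒢, ∀ h ∈ 𝒢, h ≠ g → ∀ c ∈ g.support, ¬ m.degree h ≤ c

/-- `I` is generated by squarefree monomials. -/
def IsSquarefreeMonomialIdeal (I : Ideal (MvPolynomial σ K)) : Prop :=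
  ∃ M : Set (σ →₀ ℕ), (∀ c ∈ M, ∀ i, c i ≤ 1) ∧
    I = Ideal.span ((fun c => (monomial c 1 : MvPolynomial σ K)) '' M)

end Groebner

/-! ### Lattice points, toric ideals and Cayley sums -/

section Polytopes

variable {ι : Type*}

/-- The real point with the given integer coordinates. -/
def toReal (a : ι → ℤ) : ι → ℝ := fun i => (a i : ℝ)

/-- The lattice points of `A ⊆ ℝ^ι`. -/
abbrev LatticePoints (A : Set (ι → ℝ)) : Type _ := {a : ι → ℤ // toReal a ∈ A}

/-- The toric ideal of `A`: the kernel of the map from the polynomial ring with one variable for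
each lattice point of `A` to `K[t^{±1}, s]` that sends the variable of `a` to `t^a s`.
The ring `K[t^{±1}, s]` is the monoid algebra of `ℤ^ι × ℕ`. -/
noncomputable def toricIdeal (K : Type*) [Field K] (A : Set (ι → ℝ)) :
    Ideal (MvPolynomial (LatticePoints A) K) :=
  RingHom.ker (MvPolynomial.aeval (R := K) fun a : LatticePoints A =>
    (AddMonoidAlgebra.single (a.1, 1) 1 : AddMonoidAlgebra K ((ι → ℤ) × ℕ)))

/-- The point `(a, t)`, with one coordinate more than `a`. -/
def appendCoord {R : Type*} (a : ι → R) (t : R) : Option ι → R := fun o => o.elim t a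

/-- The Cayley sum of two polytopes, in one dimension more. -/
def cayleySum (A B : Set (ι → ℝ)) : Set (Option ι → ℝ) :=
  convexHull ℝ ((fun a => appendCoord a 1) '' A ∪ (fun b => appendCoord b 0) '' B)

/-- The incidence vector `ρ(X)` of a subset `X` of the coordinates. -/
noncomputable def rho (R : Type*) [Zero R] [One R] (X : Set ι) : ι → R := X.indicator 1

theorem rho_zero_or_one (X : Set ι) (i : ι) : rho ℤ X i = 0 ∨ rho ℤ X i = 1 := by
  by_cases h : i ∈ X <;> simp [rho, h]

theorem rho_injective : Function.Injective (rho ℤ : Set ι → ι → ℤ) := by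
  intro X Y h
  exact Set.indicator_one_inj ℤ h

theorem toReal_rho (X : Set ι) : toReal (rho ℤ X) = rho ℝ X := by
  funext i
  by_cases h : i ∈ X <;> simp [toReal, rho, h]

theorem toReal_appendCoord (a : ι → ℤ) (t : ℤ) :
    toReal (appendCoord a t) = appendCoord (toReal a) (t : ℝ) := by
  funext o
  cases o <;> rfl

theorem appendCoord_injective {R : Type*} {a b : ι → R} {s t : R}
    (h : appendCoord a s = appendCoord b t) : a = b ∧ s = t :=
  ⟨funext fun i => congrFun h (some i), congrFun h none⟩

/-- A lattice point in the convex hull of a set of `0/1` vectors belongs to this set. -/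
theorem mem_of_toReal_mem_convexHull [Finite ι] {A : Set (ι → ℤ)}
    (hA : ∀ a ∈ A, ∀ i, a i = 0 ∨ a i = 1) {x : ι → ℤ}
    (hx : toReal x ∈ convexHull ℝ (toReal '' A)) : x ∈ A := by
  classical
  have := Fintype.ofFinite ι
  have hbox : ∀ i, 0 ≤ x i ∧ x i ≤ 1 := by
    intro i
    have hsub : convexHull ℝ (toReal '' A) ⊆ {y : ι → ℝ | y i ∈ Set.Icc (0 : ℝ) 1} := by
      refine convexHull_min ?_ ?_
      · rintro _ ⟨a, ha, rfl⟩
        rcases hA a ha i with h | h <;> simp [toReal, h]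
      · exact (convex_Icc (0 : ℝ) 1).is_linear_preimage
          (f := fun y : ι → ℝ => y i) ⟨fun _ _ => rfl, fun _ _ => rfl⟩
    have h := hsub hx
    simp only [Set.mem_ofPred_eq, toReal, Set.mem_Icc] at h
    exact ⟨by exact_mod_cast h.1, by exact_mod_cast h.2⟩
  let f : (ι → ℝ) →ₗ[ℝ] ℝ := ∑ i, (2 * (x i : ℝ) - 1) • LinearMap.proj i
  have hf : ∀ y, f y = ∑ i, (2 * (x i : ℝ) - 1) * y i := by
    intro y
    simp [f]
  obtain ⟨_, ⟨a, ha, rfl⟩, hle⟩ :=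
    (f.convexOn (convex_univ)).exists_ge_of_mem_convexHull (Set.subset_univ _) hx
  rw [hf, hf] at hle
  have hterm : ∀ i ∈ Finset.univ,
      (2 * (x i : ℝ) - 1) * toReal a i ≤ (2 * (x i : ℝ) - 1) * toReal x i := by
    intro i _
    have h0 : x i = 0 ∨ x i = 1 := by have := hbox i; omega
    rcases h0 with h | h <;> rcases hA a ha i with h' | h' <;> norm_num [toReal, h, h']
  have heq := (Finset.sum_eq_sum_iff_of_le hterm).1
    (le_antisymm (Finset.sum_le_sum hterm) hle)
  have : a = x := by
    funext i
    have h := heq i (Finset.mem_univ i)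
    have h0 : x i = 0 ∨ x i = 1 := by have := hbox i; omega
    rcases h0 with h1 | h1 <;> rcases hA a ha i with h2 | h2 <;>
      (simp [toReal, h1, h2] at h ⊢; try norm_num at h)
  exact this ▸ ha

theorem appendCoord_mem_convexHull {s : Set (ι → ℝ)} {t : Set (Option ι → ℝ)} (r : ℝ)
    (h : ∀ a ∈ s, appendCoord a r ∈ convexHull ℝ t) {a : ι → ℝ} (ha : a ∈ convexHull ℝ s) :
    appendCoord a r ∈ convexHull ℝ t := by
  have hsub : convexHull ℝ s ⊆ {a | appendCoord a r ∈ convexHull ℝ t} := by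
    refine convexHull_min h ?_
    intro x hx y hy α β hα hβ hαβ
    have h1 := convex_convexHull ℝ t hx hy hα hβ hαβ
    have h2 : appendCoord (α • x + β • y) r = α • appendCoord x r + β • appendCoord y r := by
      funext o
      cases o with
      | none => simp [appendCoord, ← add_mul, hαβ]
      | some i => simp [appendCoord]
    simpa only [Set.mem_ofPred_eq, h2] using h1
  exact hsub ha

end Polytopes

/-! ### Order polytopes, stable set polytopes and perfect graphs -/

section OrderStable

variable {V : Type*}

/-- A stable set of `G`. -/
def StableSet (G : SimpleGraph V) : Type _ := {S : Set V // G.IsIndepSet S}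

/-- Remove the vertex `s` from the stable set `S`. -/
def StableSet.erase {G : SimpleGraph V} (S : StableSet G) (s : V) : StableSet G :=
  ⟨S.1 \ {s}, S.2.mono Set.sdiff_subset⟩

instance [Finite V] (G : SimpleGraph V) : Finite (StableSet G) :=
  inferInstanceAs (Finite {S : Set V // G.IsIndepSet S})

/-- `G` is perfect: for every induced subgraph, the chromatic number is the maximal cardinality of a
clique. -/
def IsPerfectGraph (G : SimpleGraph V) : Prop :=
  ∀ W : Set V, (G.induce W).chromaticNumber = ((G.induce W).cliqueNum : ℕ∞)

/-- The order polytope: the convex hull of the incidence vectors of the poset ideals. -/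
def orderPolytope (V : Type*) [PartialOrder V] : Set (V → ℝ) :=
  convexHull ℝ (Set.range fun I : LowerSet V => rho ℝ (I : Set V))

/-- The stable set polytope: the convex hull of the incidence vectors of the stable sets. -/
def stableSetPolytope (G : SimpleGraph V) : Set (V → ℝ) :=
  convexHull ℝ (Set.range fun S : StableSet G => rho ℝ S.1)

/-- The variables of `ℛ_{P,G}`: `x I` for each poset ideal `I`, and `y S` for each stable set `S`.
The variable `y ∅` is the one called `z`. -/
inductive CayleyVar [PartialOrder V] (G : SimpleGraph V) : Type _
  | x (I : LowerSet V) : CayleyVar G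
  | y (S : StableSet G) : CayleyVar G

theorem CayleyVar.y_injective [PartialOrder V] {G : SimpleGraph V} :
    Function.Injective (CayleyVar.y : StableSet G → CayleyVar G) :=
  fun _ _ h => CayleyVar.y.inj h

instance [Finite V] [PartialOrder V] (G : SimpleGraph V) : Finite (CayleyVar G) := by
  have : Finite (LowerSet V) := Finite.of_injective _ SetLike.coe_injective
  refine Finite.of_injective
    (fun v : CayleyVar G => match v with
      | .x I => (Sum.inl I : LowerSet V ⊕ StableSet G)
      | .y S => Sum.inr S) ?_
  rintro (I | S) (J | T) h <;> simp_all

/-- The lattice points of the stable set polytope are the incidence vectors of the stable sets. -/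
noncomputable def stablePointEquiv [Finite V] (G : SimpleGraph V) :
    StableSet G ≃ LatticePoints (stableSetPolytope G) :=
  Equiv.ofBijective
    (fun S => ⟨rho ℤ S.1, by
      rw [toReal_rho]
      exact subset_convexHull ℝ _ ⟨S, rfl⟩⟩)
    ⟨fun _ _ h => Subtype.ext (rho_injective (congrArg Subtype.val h)), by
      rintro ⟨a, ha⟩
      have h : a ∈ Set.range fun S : StableSet G => rho ℤ S.1 := by
        refine mem_of_toReal_mem_convexHull ?_ ?_
        · rintro _ ⟨S, rfl⟩ i
          exact rho_zero_or_one _ _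
        · rw [← Set.range_comp]
          simpa only [Function.comp_def, toReal_rho, stableSetPolytope] using ha
      obtain ⟨S, rfl⟩ := h
      exact ⟨S, rfl⟩⟩

/-- The exponent of `t_1, …, t_{d+1}` in the image of a variable: `(ρ(I), 1)` for `x I` and
`(ρ(S), 0)` for `y S`. -/
noncomputable def cayleyPoint [PartialOrder V] {G : SimpleGraph V} :
    CayleyVar G → Option V → ℤ
  | .x I => appendCoord (rho ℤ (I : Set V)) 1
  | .y S => appendCoord (rho ℤ S.1) 0

theorem cayleyPoint_mem [PartialOrder V] {G : SimpleGraph V} (v : CayleyVar G) :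
    toReal (cayleyPoint v) ∈ cayleySum (orderPolytope V) (stableSetPolytope G) := by
  refine subset_convexHull ℝ _ ?_
  cases v with
  | x I =>
    refine Or.inl ⟨rho ℝ (I : Set V), subset_convexHull ℝ _ ⟨I, rfl⟩, ?_⟩
    simp [cayleyPoint, toReal_appendCoord, toReal_rho]
  | y S =>
    refine Or.inr ⟨rho ℝ S.1, subset_convexHull ℝ _ ⟨S, rfl⟩, ?_⟩
    simp [cayleyPoint, toReal_appendCoord, toReal_rho]

/-- The variables correspond to the lattice points of the Cayley sum of the order polytope and the
stable set polytope. -/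
noncomputable def cayleyPointEquiv [Finite V] [PartialOrder V] (G : SimpleGraph V) :
    CayleyVar G ≃ LatticePoints (cayleySum (orderPolytope V) (stableSetPolytope G)) :=
  Equiv.ofBijective (fun v => ⟨cayleyPoint v, cayleyPoint_mem v⟩)
    ⟨by
      intro v w h
      have h' : cayleyPoint v = cayleyPoint w := congrArg Subtype.val h
      cases v <;> cases w
      · exact congrArg _ (SetLike.coe_injective (rho_injective (appendCoord_injective h').1))
      · exact absurd (appendCoord_injective h').2 (by norm_num)
      · exact absurd (appendCoord_injective h').2 (by norm_num)
      · exact congrArg _ (Subtype.ext (rho_injective (appendCoord_injective h').1)), by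
      rintro ⟨a, ha⟩
      have h : a ∈ Set.range (cayleyPoint : CayleyVar G → Option V → ℤ) := by
        refine mem_of_toReal_mem_convexHull ?_ ?_
        · rintro _ ⟨v, rfl⟩ i
          cases v <;> cases i
          · exact Or.inr rfl
          · exact rho_zero_or_one _ _
          · exact Or.inl rfl
          · exact rho_zero_or_one _ _
        · refine convexHull_min ?_ (convex_convexHull ℝ _) ha
          rintro _ (⟨b, hb, rfl⟩ | ⟨b, hb, rfl⟩)
          · refine appendCoord_mem_convexHull 1 ?_ hb
            rintro _ ⟨I, rfl⟩
            refine subset_convexHull ℝ _ ⟨_, ⟨.x I, rfl⟩, ?_⟩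
            simp [cayleyPoint, toReal_appendCoord, toReal_rho]
          · refine appendCoord_mem_convexHull 0 ?_ hb
            rintro _ ⟨S, rfl⟩
            refine subset_convexHull ℝ _ ⟨_, ⟨.y S, rfl⟩, ?_⟩
            simp [cayleyPoint, toReal_appendCoord, toReal_rho]
      obtain ⟨v, rfl⟩ := h
      exact ⟨v, rfl⟩⟩

variable (K : Type*) [Field K]

/-- The toric ideal of the stable set polytope, in the variables `y S`. -/
noncomputable def stableToricIdeal [Finite V] (G : SimpleGraph V) :
    Ideal (MvPolynomial (StableSet G) K) :=
  (toricIdeal K (stableSetPolytope G)).comap (rename (R := K) (stablePointEquiv G))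

/-- The toric ideal of the Cayley sum of the order polytope and the stable set polytope, in the
variables `x I`, `y S`. -/
noncomputable def cayleyToricIdeal [Finite V] [PartialOrder V] (G : SimpleGraph V) :
    Ideal (MvPolynomial (CayleyVar G) K) :=
  (toricIdeal K (cayleySum (orderPolytope V) (stableSetPolytope G))).comap
    (rename (R := K) (cayleyPointEquiv G))

/-- The conditions on the ordering of the variables. The condition `z < y S` for `S ≠ ∅` is the case
`S' = ∅` of the third one. -/
structure IsCompatibleOrder [PartialOrder V] {G : SimpleGraph V} (lo : LinearOrder (CayleyVar G)) :
    Prop where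
  y_lt_x : ∀ (S : StableSet G) (I : LowerSet V), lo.lt (.y S) (.x I)
  x_lt_x : ∀ I I' : LowerSet V, (I : Set V) ⊂ (I' : Set V) → lo.lt (.x I') (.x I)
  y_lt_y : ∀ S S' : StableSet G, S'.1 ⊂ S.1 → lo.lt (.y S') (.y S)

/-- The ordering of the variables `y S` (including `z = y ∅`) induced by an ordering of all
variables. -/
@[reducible]
noncomputable def restrictOrder [PartialOrder V] {G : SimpleGraph V}
    (lo : LinearOrder (CayleyVar G)) : LinearOrder (StableSet G) :=
  @LinearOrder.lift' _ _ lo CayleyVar.y CayleyVar.y_injective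

/-- The set `𝒢_P` of the binomials `x_I x_J - x_{I ∩ J} x_{I ∪ J}` for incomparable poset ideals. -/
def hibiBinomials [PartialOrder V] (G : SimpleGraph V) : Set (MvPolynomial (CayleyVar G) K) :=
  {f | ∃ I J : LowerSet V, ¬ (I : Set V) ⊆ J ∧ ¬ (J : Set V) ⊆ I ∧
    f = X (.x I) * X (.x J) - X (.x (I ⊓ J)) * X (.x (I ⊔ J))}

/-- The set `𝒢` of the binomials `x_I y_S - x_{I ∪ {s}} y_{S ∖ {s}}`, where `s ∈ S ∖ I` and
`I ∪ {s}` is a poset ideal. -/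
def mixedBinomials [PartialOrder V] (G : SimpleGraph V) : Set (MvPolynomial (CayleyVar G) K) :=
  {f | ∃ (I I' : LowerSet V) (S : StableSet G) (s : V), s ∈ S.1 \ (I : Set V) ∧
    (I' : Set V) = (I : Set V) ∪ {s} ∧
    f = X (.x I) * X (.y S) - X (.x I') * X (.y (S.erase s))}

end OrderStable

/-! ### Initial ideals and reduced Gröbner bases -/

section MonomialOrder

open scoped MonomialOrder

variable {σ K : Type*} [Field K] {m : MonomialOrder σ}

/-! Each toric ideal is the kernel of a monomial map, so a monomial is initial exactly when a
revlex-smaller monomial has the same image (`mem_initialExponents_monomialKernel`). Everything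
becomes a comparison of multisets: two monomials have the same image when they contain equally many
poset ideals, equally many stable sets, and cover every vertex equally often (`cayley_fiber_iff`).

Let `v < u` lie in one fibre and suppose that no Hibi or mixed initial monomial divides `u`. Cancel
common factors; then `v` has a variable smaller than all variables of `u`. The poset ideals of `u`
form a chain, and since no mixed exchange is possible they cover each vertex at least as often as
those of `v` (`idealCount_le_of_fiber`). If the small variable were some `x I'`, no `y` would remain
in `u` and the largest ideal of `u` would contain `I'`, against the ordering. So it is some `y T`,
and the stable sets of `u` cover each vertex at most as often as those of `v`.

Here perfectness enters (`IsPerfectGraph.exists_revLexLT`). By the replication lemma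
(`IsPerfectGraph.exists_stableCount_eq`) a weight is a sum of `m` stable sets, empty ones allowed,
as soon as its clique sums are at most `m`. Trim `T` to the vertices covered by the stable sets of
`u`. Removing the trimmed set lowers every tight clique sum, so the remaining weight needs one
stable set fewer. This gives a smaller monomial in the fibre of the `y`-part of `u`, which is
therefore initial for the stable set polytope.

The exchange depends only on which stable sets occur, not on their multiplicities. Hence the initial
ideal of the stable set polytope is radical, and squarefreeness follows because the Hibi and mixed
initial monomials are squarefree. -/

theorem mem_span_monomial_iff (M : Set (σ →₀ ℕ)) (c : σ →₀ ℕ) :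
    (monomial c 1 : MvPolynomial σ K) ∈
      Ideal.span ((fun c => (monomial c 1 : MvPolynomial σ K)) '' M) ↔ ∃ d ∈ M, d ≤ c := by
  classical
  rw [mem_ideal_span_monomial_image]
  simp [support_monomial]

theorem MonomialOrder.lt_of_mem_support {f : MvPolynomial σ K} {c : σ →₀ ℕ} (hc : c ∈ f.support)
    (h : c ≠ m.degree f) : c ≺[m] m.degree f :=
  lt_of_le_of_ne (m.le_degree hc) fun h' => h (m.toSyn.injective h')

theorem initialMonomial_image (m : MonomialOrder σ) (𝒢 : Set (MvPolynomial σ K)) :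
    initialMonomial m '' 𝒢 = (fun c => (monomial c 1 : MvPolynomial σ K)) '' (m.degree '' 𝒢) := by
  rw [Set.image_image]
  rfl

/-- The exponents of the initial monomials of the nonzero elements of `I`. -/
def initialExponents (m : MonomialOrder σ) (I : Ideal (MvPolynomial σ K)) : Set (σ →₀ ℕ) :=
  {c | ∃ f ∈ I, f ≠ 0 ∧ m.degree f = c}

theorem initialIdeal_eq (m : MonomialOrder σ) (I : Ideal (MvPolynomial σ K)) :
    initialIdeal m I =
      Ideal.span ((fun c => (monomial c 1 : MvPolynomial σ K)) '' initialExponents m I) := by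
  unfold initialIdeal
  congr 1
  ext u
  constructor
  · rintro ⟨f, hf, h0, rfl⟩
    exact ⟨_, ⟨f, hf, h0, rfl⟩, rfl⟩
  · rintro ⟨_, ⟨f, hf, h0, rfl⟩, rfl⟩
    exact ⟨f, hf, h0, rfl⟩

theorem initialExponents_mono (I : Ideal (MvPolynomial σ K)) {c d : σ →₀ ℕ} (h : c ≤ d)
    (hc : c ∈ initialExponents m I) : d ∈ initialExponents m I := by
  classical
  obtain ⟨e, rfl⟩ := exists_add_of_le h
  obtain ⟨f, hf, h0, rfl⟩ := hc
  have hm : (monomial e (1 : K)) ≠ 0 := by simp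
  refine ⟨f * monomial e 1, I.mul_mem_right _ hf, mul_ne_zero h0 hm, ?_⟩
  rw [m.degree_mul h0 hm, m.degree_monomial, if_neg one_ne_zero]

theorem IsGroebnerBasis.exists_degree_le {𝒢 : Set (MvPolynomial σ K)}
    {I : Ideal (MvPolynomial σ K)} (h : IsGroebnerBasis m 𝒢 I) {c : σ →₀ ℕ}
    (hc : c ∈ initialExponents m I) : ∃ g ∈ 𝒢, m.degree g ≤ c := by
  have h1 : (monomial c 1 : MvPolynomial σ K) ∈ initialIdeal m I := by
    rw [initialIdeal_eq]
    exact Ideal.subset_span ⟨c, hc, rfl⟩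
  rw [← h.span_initial, initialMonomial_image, mem_span_monomial_iff] at h1
  obtain ⟨_, ⟨g, hg, rfl⟩, hle⟩ := h1
  exact ⟨g, hg, hle⟩

theorem isGroebnerBasis_of_exists_degree_le {𝒢 : Set (MvPolynomial σ K)}
    {I : Ideal (MvPolynomial σ K)} (hfin : 𝒢.Finite) (hsub : 𝒢 ⊆ I) (hne : ∀ g ∈ 𝒢, g ≠ 0)
    (h : ∀ c ∈ initialExponents m I, ∃ g ∈ 𝒢, m.degree g ≤ c) : IsGroebnerBasis m 𝒢 I := by
  refine ⟨hfin, hsub, hne, le_antisymm ?_ ?_⟩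
  · rw [initialIdeal_eq, initialMonomial_image]
    refine Ideal.span_mono (Set.image_mono ?_)
    rintro _ ⟨g, hg, rfl⟩
    exact ⟨g, hsub hg, hne g hg, rfl⟩
  · rw [initialIdeal_eq, initialMonomial_image, Ideal.span_le]
    rintro _ ⟨c, hc, rfl⟩
    obtain ⟨g, hg, hle⟩ := h c hc
    exact (mem_span_monomial_iff _ _).2 ⟨_, ⟨g, hg, rfl⟩, hle⟩

/-- A basis element whose initial monomial divides `c` cannot be `g` itself, because `c` lies below
the initial monomial of `g`; reducedness excludes all the others. -/
theorem IsReducedGroebnerBasis.not_mem_initialExponents {𝒢 : Set (MvPolynomial σ K)}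
    {I : Ideal (MvPolynomial σ K)} (h : IsReducedGroebnerBasis m 𝒢 I) {g : MvPolynomial σ K}
    (hg : g ∈ 𝒢) {c : σ →₀ ℕ} (hc : c ∈ g.support) (hlt : c ≺[m] m.degree g) :
    c ∉ initialExponents m I := by
  intro hcI
  obtain ⟨k, hk, hle⟩ := h.toIsGroebnerBasis.exists_degree_le hcI
  refine h.reduced g hg k hk ?_ c hc hle
  rintro rfl
  exact absurd (m.toSyn_monotone hle) (not_le.2 hlt)

/-- Used in both directions for uniqueness. Elements of the two bases with the same initial monomial
differ by an element of `I` whose initial monomial would be a non-initial monomial of one of them,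
hence standard; so the difference vanishes. -/
theorem IsReducedGroebnerBasis.subset_of_isReduced {A B : Set (MvPolynomial σ K)}
    {I : Ideal (MvPolynomial σ K)} (hA : IsReducedGroebnerBasis m A I)
    (hB : IsReducedGroebnerBasis m B I) : A ⊆ B := by
  intro g hg
  have hgI : m.degree g ∈ initialExponents m I := ⟨g, hA.subset hg, hA.ne_zero g hg, rfl⟩
  obtain ⟨k, hk, hkg⟩ := hB.toIsGroebnerBasis.exists_degree_le hgI
  have hkI : m.degree k ∈ initialExponents m I := ⟨k, hB.subset hk, hB.ne_zero k hk, rfl⟩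
  obtain ⟨g', hg', hgk⟩ := hA.toIsGroebnerBasis.exists_degree_le hkI
  -- The initial monomial of `g'` divides that of `k`, which divides that of `g`; reducedness of `A`
  -- closes the circle.
  have hgg : g' = g := by
    by_contra hne
    exact hA.reduced g hg g' hg' hne _ (m.degree_mem_support (hA.ne_zero g hg)) (hgk.trans hkg)
  have hdeg : m.degree k = m.degree g := le_antisymm hkg (hgg ▸ hgk)
  suffices h : g - k = 0 by rwa [sub_eq_zero.1 h]
  by_contra hne
  have hcI : m.degree (g - k) ∈ initialExponents m I :=
    ⟨g - k, I.sub_mem (hA.subset hg) (hB.subset hk), hne, rfl⟩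
  have hc := m.degree_mem_support hne
  have hne' : m.degree (g - k) ≠ m.degree g := by
    intro h
    rw [mem_support_iff, h, coeff_sub, (hA.monic g hg).coeff_degree, ← hdeg,
      (hB.monic k hk).coeff_degree, sub_self] at hc
    exact hc rfl
  have hor : m.degree (g - k) ∈ g.support ∨ m.degree (g - k) ∈ k.support := by
    by_contra hcon
    simp only [mem_support_iff, not_or, not_not] at hcon
    rw [mem_support_iff, coeff_sub, hcon.1, hcon.2, sub_self] at hc
    exact hc rfl
  rcases hor with h | h
  · exact hA.not_mem_initialExponents hg h (m.lt_of_mem_support h hne') hcI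
  · exact hB.not_mem_initialExponents hk h (m.lt_of_mem_support h (hdeg ▸ hne')) hcI

theorem degree_monomial_sub_monomial {c d : σ →₀ ℕ} (h : d ≺[m] c) :
    m.degree (monomial c 1 - monomial d 1 : MvPolynomial σ K) = c := by
  classical
  have hd : m.degree (monomial d 1 : MvPolynomial σ K) = d := by
    rw [m.degree_monomial, if_neg one_ne_zero]
  have hc : m.degree (monomial c 1 : MvPolynomial σ K) = c := by
    rw [m.degree_monomial, if_neg one_ne_zero]
  rw [m.degree_sub_of_lt (by rwa [hd, hc]), hc]

theorem coeff_monomial_sub_monomial {c d : σ →₀ ℕ} (h : d ≺[m] c) :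
    coeff c (monomial c 1 - monomial d 1 : MvPolynomial σ K) = 1 := by
  classical
  have : d ≠ c := by
    rintro rfl
    exact lt_irrefl _ h
  simp [coeff_monomial, this]

theorem monomial_sub_monomial_ne_zero {c d : σ →₀ ℕ} (h : d ≺[m] c) :
    (monomial c 1 - monomial d 1 : MvPolynomial σ K) ≠ 0 := by
  intro h0
  have := coeff_monomial_sub_monomial (K := K) h
  rw [h0, coeff_zero] at this
  exact zero_ne_one this

end MonomialOrder

/-! ### Kernels of monomial maps -/

section Toric

open scoped MonomialOrder

variable {σ M : Type*} [AddCommMonoid M]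

/-- The kernel of the map that sends the variable `i` to the monomial with exponent `a i`. -/
noncomputable def monomialKernel (K : Type*) [Field K] (a : σ → M) : Ideal (MvPolynomial σ K) :=
  RingHom.ker (aeval (R := K) fun i => (AddMonoidAlgebra.single (a i) 1 : AddMonoidAlgebra K M))

variable {K : Type*} [Field K] {a : σ → M}

theorem aeval_single_monomial (a : σ → M) (c : σ →₀ ℕ) (r : K) :
    aeval (R := K) (fun i => (AddMonoidAlgebra.single (a i) 1 : AddMonoidAlgebra K M))
      (monomial c r) = AddMonoidAlgebra.single (Finsupp.linearCombination ℕ a c) r := by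
  have h1 : ∀ c : σ →₀ ℕ, aeval (R := K)
      (fun i => (AddMonoidAlgebra.single (a i) 1 : AddMonoidAlgebra K M)) (monomial c 1) =
      AddMonoidAlgebra.single (Finsupp.linearCombination ℕ a c) 1 := by
    intro c
    induction c using Finsupp.induction_linear with
    | zero =>
      rw [map_zero, show monomial (0 : σ →₀ ℕ) (1 : K) = 1 from rfl, map_one,
        AddMonoidAlgebra.one_def]
    | add f g hf hg =>
      rw [show monomial (f + g) (1 : K) = monomial f 1 * monomial g 1 by
        rw [monomial_mul, one_mul], map_mul, hf, hg, AddMonoidAlgebra.single_mul_single,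
        map_add, one_mul]
    | single i n =>
      rw [aeval_monomial, Finsupp.prod_single_index (by simp), AddMonoidAlgebra.single_pow]
      simp
  rw [← mul_one r, ← smul_eq_mul, ← smul_monomial, map_smul, h1, AddMonoidAlgebra.smul_single]

theorem monomial_sub_monomial_mem_monomialKernel {c d : σ →₀ ℕ}
    (h : Finsupp.linearCombination ℕ a c = Finsupp.linearCombination ℕ a d) :
    (monomial c 1 - monomial d 1 : MvPolynomial σ K) ∈ monomialKernel K a := by
  rw [monomialKernel, RingHom.mem_ker, map_sub, aeval_single_monomial, aeval_single_monomial, h,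
    sub_self]

/-- Otherwise the leading coefficient would be the only contribution to the coefficient of the image
at the exponent of the leading term, and nothing could cancel it. -/
theorem exists_lt_of_mem_monomialKernel {m : MonomialOrder σ} {f : MvPolynomial σ K}
    (hf : f ∈ monomialKernel K a) (h0 : f ≠ 0) : ∃ d, d ≺[m] m.degree f ∧
      Finsupp.linearCombination ℕ a d = Finsupp.linearCombination ℕ a (m.degree f) := by
  classical
  by_contra! hcon
  have h1 := RingHom.mem_ker.1 hf
  rw [f.as_sum, map_sum] at h1
  simp only [aeval_single_monomial] at h1
  have h2 := congrArg (fun p => p.coeff (Finsupp.linearCombination ℕ a (m.degree f))) h1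
  simp only [AddMonoidAlgebra.coeff_sum, AddMonoidAlgebra.coeff_single, Finsupp.finsetSum_apply,
    AddMonoidAlgebra.coeff_zero, Finsupp.coe_zero, Pi.zero_apply] at h2
  rw [Finset.sum_eq_single (m.degree f)] at h2
  · rw [Finsupp.single_eq_same] at h2
    exact m.coeff_degree_ne_zero_iff.2 h0 h2
  · intro c hc hne
    exact Finsupp.single_eq_of_ne' (hcon c (m.lt_of_mem_support hc hne))
  · intro h
    exact absurd (m.degree_mem_support h0) h

theorem mem_initialExponents_monomialKernel {m : MonomialOrder σ} {c : σ →₀ ℕ} :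
    c ∈ initialExponents m (monomialKernel K a) ↔ ∃ d, d ≺[m] c ∧
      Finsupp.linearCombination ℕ a d = Finsupp.linearCombination ℕ a c := by
  constructor
  · rintro ⟨f, hf, h0, rfl⟩
    exact exists_lt_of_mem_monomialKernel hf h0
  · rintro ⟨d, hd, h⟩
    exact ⟨_, monomial_sub_monomial_mem_monomialKernel h.symm, monomial_sub_monomial_ne_zero hd,
      degree_monomial_sub_monomial hd⟩

/-- The kernel of a monomial map has a reduced Gröbner basis: its elements are the differences of
a minimal nonstandard monomial and the standard monomial with the same image. -/
theorem exists_isReducedGroebnerBasis_monomialKernel [Finite σ] (m : MonomialOrder σ)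
    (K : Type*) [Field K] (a : σ → M) :
    ∃ 𝒢 : Set (MvPolynomial σ K), IsReducedGroebnerBasis m 𝒢 (monomialKernel K a) := by
  classical
  have hstd : ∀ c : σ →₀ ℕ, ∃ d, Finsupp.linearCombination ℕ a d = Finsupp.linearCombination ℕ a c ∧
      d ∉ initialExponents m (monomialKernel K a) ∧
      (c ∈ initialExponents m (monomialKernel K a) → d ≺[m] c) := by
    intro c
    -- The least monomial of a fibre is its standard monomial.
    obtain ⟨s, ⟨d, hd, rfl⟩, hmin⟩ := WellFounded.has_min (wellFounded_lt (α := m.syn))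
      (m.toSyn '' {d | Finsupp.linearCombination ℕ a d = Finsupp.linearCombination ℕ a c})
      ⟨_, c, rfl, rfl⟩
    have hd' : d ∉ initialExponents m (monomialKernel K a) := by
      rw [mem_initialExponents_monomialKernel]
      rintro ⟨e, he, h⟩
      exact hmin _ ⟨e, h.trans hd, rfl⟩ he
    refine ⟨d, hd, hd', fun hc => ?_⟩
    refine lt_of_le_of_ne (not_lt.1 (hmin _ ⟨c, rfl, rfl⟩)) fun h => ?_
    exact hd' (m.toSyn.injective h ▸ hc)
  choose ν hν hνstd hνlt using hstd
  let E : Set (σ →₀ ℕ) := {c | Minimal (· ∈ initialExponents m (monomialKernel K a)) c}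
  -- Dickson's lemma.
  have hE : E.Finite := WellQuasiOrderedLE.finite_of_isAntichain (setOfPred_minimal_antichain _)
  have hlt : ∀ c ∈ E, ν c ≺[m] c := fun c hc => hνlt c hc.prop
  refine ⟨(fun c => (monomial c 1 - monomial (ν c) 1 : MvPolynomial σ K)) '' E,
    isGroebnerBasis_of_exists_degree_le (hE.image _) ?_ ?_ ?_, ?_, ?_⟩
  · rintro _ ⟨c, -, rfl⟩
    exact monomial_sub_monomial_mem_monomialKernel (hν c).symm
  · rintro _ ⟨c, hc, rfl⟩
    exact monomial_sub_monomial_ne_zero (hlt c hc)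
  · intro c hc
    obtain ⟨d, hdc, hd⟩ := exists_minimal_le_of_wellFoundedLT
      (· ∈ initialExponents m (monomialKernel K a)) c hc
    exact ⟨_, ⟨d, hd, rfl⟩, (degree_monomial_sub_monomial (hlt d hd)).trans_le hdc⟩
  · rintro _ ⟨c, hc, rfl⟩
    rw [MonomialOrder.Monic, MonomialOrder.leadingCoeff, degree_monomial_sub_monomial (hlt c hc),
      coeff_monomial_sub_monomial (hlt c hc)]
  · rintro _ ⟨c, hc, rfl⟩ _ ⟨d, hd, rfl⟩ hne e he hle
    rw [degree_monomial_sub_monomial (hlt d hd)] at hle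
    have he' : e = c ∨ e = ν c := by
      by_contra! hcon
      simp [coeff_monomial, hcon.1.symm, hcon.2.symm] at he
    rcases he' with rfl | rfl
    · exact hne (by rw [hc.eq_of_le hd.prop hle])
    · exact hνstd c (initialExponents_mono _ hle hd.prop)

end Toric

/-! ### Comparing exponent vectors in the reverse lexicographic order -/

section RevLexCompare

variable {σ : Type*} {lo : LinearOrder σ}

/-- If some variable of `a` is smaller than all variables of `b`, then `a < b`. -/
theorem revLexLT_of_forall_lt {a b : σ →₀ ℕ} (hdeg : a.degree = b.degree) {i : σ} (hi : 0 < a i)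
    (h : ∀ j, 0 < b j → lo.lt i j) : revLexLT lo a b := by
  -- The smallest variable of `a` lies below all variables of `b`, so it is the first one at which
  -- `a` and `b` differ.
  obtain ⟨k, hk, hmin⟩ := Finset.exists_minimal (s := a.support) ⟨i, Finsupp.mem_support_iff.2 hi.ne'⟩
  have hki : lo.le k i := by
    rcases lo.le_total k i with h1 | h1
    · exact h1
    · exact hmin (Finsupp.mem_support_iff.2 hi.ne') h1
  have hb : ∀ j, lo.le j k → b j = 0 := by
    intro j hj
    by_contra hne
    exact absurd (h j (Nat.pos_of_ne_zero hne))
      (not_lt_of_ge (lo.le_trans _ _ _ hj hki))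
  refine Or.inr ⟨hdeg, k, fun j hj => ?_, ?_⟩
  · rw [hb j (le_of_lt hj)]
    by_contra hne
    exact absurd hj
      (not_lt_of_ge (hmin (Finsupp.mem_support_iff.2 hne)
        (le_of_lt hj)))
  · rw [hb k (lo.le_refl k)]
    exact Nat.pos_of_ne_zero (Finsupp.mem_support_iff.1 hk)

/-- After cancelling common factors, the smaller of two monomials of the same degree has a variable
that is smaller than all variables of the other one. -/
theorem exists_forall_lt_of_revLexLT {a b : σ →₀ ℕ} (hdeg : a.degree = b.degree)
    (h : revLexLT lo a b) : ∃ i, 0 < (a - b) i ∧ ∀ j, 0 < (b - a) j → lo.lt i j := by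
  rcases h with h | ⟨-, i, hi, hlt⟩
  · exact absurd hdeg h.ne
  · refine ⟨i, by simpa using hlt, fun j hj => ?_⟩
    have hj' : a j < b j := by simpa using hj
    rcases lt_trichotomy i j with h | h | h
    · exact h
    · subst h
      exact absurd hj' hlt.not_gt
    · exact absurd (hi j h) hj'.ne

end RevLexCompare

/-! ### Stable sets covering a weighted perfect graph -/

section Perfect

open scoped Classical in
/-- The number of members of a multiset of sets that contain `p`; the multiset is given by the
multiplicities `c` of the sets `s i`. -/
noncomputable def coverCount {σ V : Type*} (s : σ → Set V) (p : V) : (σ →₀ ℕ) →+ ℕ :=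
  (Finsupp.linearCombination ℕ fun i => if p ∈ s i then 1 else 0).toAddMonoidHom

section CoverCount

open scoped Classical

variable {σ V : Type*} {s : σ → Set V}

theorem coverCount_single (p : V) (i : σ) (n : ℕ) :
    coverCount s p (Finsupp.single i n) = if p ∈ s i then n else 0 := by
  simp [coverCount]

theorem coverCount_eq_sum (p : V) (c : σ →₀ ℕ) :
    coverCount s p c = ∑ i ∈ c.support, if p ∈ s i then c i else 0 := by
  simp [coverCount, Finsupp.linearCombination_apply, Finsupp.sum]

theorem coverCount_pos_iff {p : V} {c : σ →₀ ℕ} :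
    0 < coverCount s p c ↔ ∃ i, 0 < c i ∧ p ∈ s i := by
  rw [coverCount_eq_sum]
  constructor
  · intro h
    obtain ⟨i, hi, hne⟩ := Finset.exists_ne_zero_of_sum_ne_zero h.ne'
    by_cases hp : p ∈ s i
    · rw [if_pos hp] at hne
      exact ⟨i, Nat.pos_of_ne_zero hne, hp⟩
    · exact absurd (if_neg hp) hne
  · rintro ⟨i, hi, hp⟩
    refine Finset.sum_pos' (fun _ _ => Nat.zero_le _) ⟨i, Finsupp.mem_support_iff.2 hi.ne', ?_⟩
    rwa [if_pos hp]

/-- Double counting of the incidences between `C` and the multiset. -/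
theorem sum_coverCount (C : Finset V) (c : σ →₀ ℕ) :
    ∑ p ∈ C, coverCount s p c = ∑ i ∈ c.support, c i * {p ∈ C | p ∈ s i}.card := by
  simp_rw [coverCount_eq_sum]
  rw [Finset.sum_comm]
  refine Finset.sum_congr rfl fun i _ => ?_
  rw [← Finset.sum_filter, Finset.sum_const, smul_eq_mul, mul_comm]

end CoverCount

variable {V : Type*} {G : SimpleGraph V}

open scoped Classical in
theorem card_filter_mem_stable_le_one {C : Finset V} (hC : G.IsClique C) (S : StableSet G) :
    {p ∈ C | p ∈ S.1}.card ≤ 1 := by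
  rw [Finset.card_le_one]
  intro p hp q hq
  simp only [Finset.mem_filter] at hp hq
  by_contra hne
  exact S.2 hp.2 hq.2 hne (hC hp.1 hq.1 hne)

/-- How often the stable sets of a multiset contain `p`. -/
noncomputable abbrev stableCount (p : V) : (StableSet G →₀ ℕ) →+ ℕ :=
  coverCount (fun S : StableSet G => S.1) p

/-- Each stable set meets a clique in at most one vertex. The equality case below says that a clique
is tight exactly when every member meets it. -/
theorem sum_stableCount_le_degree {C : Finset V} (hC : G.IsClique C) (c : StableSet G →₀ ℕ) :
    ∑ p ∈ C, stableCount p c ≤ c.degree := by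
  classical
  rw [sum_coverCount, Finsupp.degree_apply]
  refine Finset.sum_le_sum fun S _ => ?_
  exact (Nat.mul_le_mul_left _ (by convert card_filter_mem_stable_le_one hC S)).trans_eq
    (mul_one _)

theorem sum_stableCount_eq_degree_iff {C : Finset V} (hC : G.IsClique C) (c : StableSet G →₀ ℕ) :
    ∑ p ∈ C, stableCount p c = c.degree ↔ ∀ S, 0 < c S → ∃ p ∈ C, p ∈ S.1 := by
  classical
  have hle : ∀ S ∈ c.support, c S * {p ∈ C | p ∈ S.1}.card ≤ c S := fun S _ =>
    (Nat.mul_le_mul_left _ (card_filter_mem_stable_le_one hC S)).trans_eq (mul_one _)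
  have hkey : ∑ p ∈ C, stableCount p c = ∑ S ∈ c.support, c S * {p ∈ C | p ∈ S.1}.card := by
    rw [sum_coverCount]
  rw [hkey, Finsupp.degree_apply, Finset.sum_eq_sum_iff_of_le hle]
  refine forall_congr' fun S => ?_
  rw [Finsupp.mem_support_iff, Nat.pos_iff_ne_zero]
  refine imp_congr_right fun hS => ?_
  have h1 := card_filter_mem_stable_le_one hC S
  rw [Nat.mul_eq_left hS]
  constructor
  · intro h
    obtain ⟨p, hp⟩ := Finset.card_pos.1 (h ▸ Nat.one_pos)
    exact ⟨p, (Finset.mem_filter.1 hp).1, (Finset.mem_filter.1 hp).2⟩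
  · rintro ⟨p, hp, hpS⟩
    exact le_antisymm h1 (Finset.card_pos.2 ⟨p, Finset.mem_filter.2 ⟨hp, hpS⟩⟩)

/-- A colouring of the subgraph on `W` with `n` colours gives `n` stable sets that partition `W`. -/
theorem exists_stableCount_eq_indicator [Finite V] {W : Set V} {n : ℕ}
    (h : (G.induce W).Colorable n) : ∃ c : StableSet G →₀ ℕ, c.degree = n ∧
      ∀ p, stableCount p c = W.indicator 1 p := by
  classical
  obtain ⟨f⟩ := h
  let S : Fin n → StableSet G := fun i => ⟨{p | ∃ h : p ∈ W, f ⟨p, h⟩ = i}, by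
    rintro p ⟨hp, hpi⟩ q ⟨hq, hqi⟩ - hadj
    exact f.valid (v := ⟨p, hp⟩) (w := ⟨q, hq⟩) hadj (hpi.trans hqi.symm)⟩
  -- Unused colours contribute the empty stable set, so the multiset has exactly `n` members.
  refine ⟨∑ i, Finsupp.single (S i) 1, by simp [map_sum], fun p => ?_⟩
  rw [map_sum]
  simp_rw [coverCount_single]
  by_cases hp : p ∈ W
  · rw [Set.indicator_of_mem hp, Finset.sum_eq_single (f ⟨p, hp⟩), if_pos ⟨hp, rfl⟩, Pi.one_apply]
    · rintro i - hi
      exact if_neg fun ⟨_, h⟩ => hi h.symm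
    · simp
  · rw [Set.indicator_of_notMem hp]
    exact Finset.sum_eq_zero fun i _ => if_neg fun ⟨h, _⟩ => hp h

/-- Lovász's replication lemma: in a perfect graph, a weight whose sum over every clique is at most
`m` is the sum of `m` stable sets. -/
theorem IsPerfectGraph.exists_stableCount_eq [Finite V] (hG : IsPerfectGraph G) (w : V → ℕ) (m : ℕ)
    (hw : ∀ C : Finset V, G.IsClique C → ∑ p ∈ C, w p ≤ m) :
    ∃ c : StableSet G →₀ ℕ, c.degree = m ∧ ∀ p, stableCount p c = w p := by
  classical
  have := Fintype.ofFinite V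
  induction hN : ∑ p, w p using Nat.strong_induction_on generalizing w m with
  | _ N ih =>
  subst hN
  by_cases hle : ∀ p, w p ≤ 1
  -- For a 0/1 weight the bound says that cliques in the support have at most `m` vertices, so
  -- perfectness supplies a colouring with `m` colours.
  · let W : Set V := {p | w p = 1}
    have hcl : (G.induce W).cliqueNum ≤ m := by
      obtain ⟨C, hC⟩ := (G.induce W).exists_isNClique_cliqueNum
      have h1 := hw (C.map (Function.Embedding.subtype _)) (by
        rintro _ hp _ hq hne
        simp only [Finset.coe_map, Set.mem_image, Finset.mem_coe] at hp hq
        obtain ⟨p, hp, rfl⟩ := hp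
        obtain ⟨q, hq, rfl⟩ := hq
        exact hC.isClique hp hq fun h => hne (h ▸ rfl))
      rw [Finset.sum_map, Finset.sum_congr rfl (fun p _ => p.2), Finset.sum_const, smul_eq_mul,
        mul_one, hC.card_eq] at h1
      exact h1
    have hcol : (G.induce W).Colorable m := by
      rw [← SimpleGraph.chromaticNumber_le_iff_colorable, hG W]
      exact_mod_cast hcl
    obtain ⟨c, hc, hcW⟩ := exists_stableCount_eq_indicator hcol
    refine ⟨c, hc, fun p => ?_⟩
    rw [hcW]
    by_cases hp : w p = 1
    · rw [Set.indicator_of_mem (show p ∈ W from hp), hp, Pi.one_apply]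
    · rw [Set.indicator_of_notMem (show p ∉ W from hp)]
      have := hle p
      omega
  push Not at hle
  obtain ⟨x, hx⟩ := hle
  -- Some vertex `x` has weight at least 2. Lowering it by one keeps it positive, so the
  -- decomposition of the lowered weight has a member through `x`.
  let w' : V → ℕ := fun p => w p - if p = x then 1 else 0
  have hw'x : w' x = w x - 1 := by simp [w']
  have hw'ne : ∀ p, p ≠ x → w' p = w p := fun p hp => by simp [w', hp]
  have hw'le : ∀ p, w' p ≤ w p := fun p => Nat.sub_le _ _
  have hlt : ∑ p, w' p < ∑ p, w p :=
    Finset.sum_lt_sum (fun p _ => hw'le p) ⟨x, Finset.mem_univ x, by omega⟩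
  obtain ⟨c, hc, hcw⟩ := ih _ hlt w' m
    (fun C hC => (Finset.sum_le_sum fun p _ => hw'le p).trans (hw C hC)) rfl
  obtain ⟨A, hA, hxA⟩ := coverCount_pos_iff.1 (show 0 < stableCount x c by rw [hcw]; omega)
  -- That member `A` is removed from the original weight, and what remains should need only `m - 1`
  -- stable sets.
  let w'' : V → ℕ := fun p => w p - if p ∈ A.1 then 1 else 0
  have hAw : ∀ p ∈ A.1, 0 < w' p := fun p hp => by
    rw [← hcw]
    exact coverCount_pos_iff.2 ⟨A, hA, hp⟩
  have hw'' : ∀ p, w'' p + (if p ∈ A.1 then 1 else 0) = w p := by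
    intro p
    by_cases hp : p ∈ A.1
    · have := hAw p hp
      have := hw'le p
      simp only [w'', if_pos hp]
      omega
    · simp [w'', hp]
  have hw''le : ∀ p, w'' p ≤ w' p := by
    intro p
    by_cases hp : p = x
    · subst hp
      simp [w'', w', hxA]
    · rw [hw'ne p hp]
      exact Nat.sub_le _ _
  have hm : 1 ≤ m := by
    have := hw {x} (by simp)
    rw [Finset.sum_singleton] at this
    omega
  have hclique : ∀ C : Finset V, G.IsClique C → ∑ p ∈ C, w'' p ≤ m - 1 := by
    intro C hC
    have hmeet : (∃ p ∈ C, p ∈ A.1) → ∑ p ∈ C, w'' p < ∑ p ∈ C, w p := by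
      rintro ⟨p, hp, hpA⟩
      refine Finset.sum_lt_sum (fun q _ => ?_) ⟨p, hp, ?_⟩
      · exact (hw''le q).trans (hw'le q)
      · have := hw'' p
        rw [if_pos hpA] at this
        omega
    have h1 := hw C hC
    by_cases hmeet' : ∃ p ∈ C, p ∈ A.1
    · have := hmeet hmeet'
      omega
    -- A clique missing `A` is not tight for `w'`, since every member of `c` meets a tight clique.
    · have h2 : ∑ p ∈ C, w' p ≠ m := by
        intro h
        have h3 : ∑ p ∈ C, stableCount p c = c.degree := by
          rw [hc, ← h]
          exact Finset.sum_congr rfl fun p _ => hcw p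
        exact hmeet' ((sum_stableCount_eq_degree_iff hC c).1 h3 A hA)
      have h3 : ∑ p ∈ C, w'' p ≤ ∑ p ∈ C, w' p := Finset.sum_le_sum fun p _ => hw''le p
      have h4 : ∑ p ∈ C, w' p ≤ ∑ p ∈ C, w p := Finset.sum_le_sum fun p _ => hw'le p
      omega
  obtain ⟨d, hd, hdw⟩ := ih _ ((Finset.sum_le_sum fun p _ => hw''le p).trans_lt hlt) w'' (m - 1)
    hclique rfl
  refine ⟨d + Finsupp.single A 1, ?_, fun p => ?_⟩
  · rw [map_add, hd, Finsupp.degree_single]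
    omega
  · rw [map_add, hdw, coverCount_single, hw'']

/-- A multiset `b` of stable sets can be replaced by a revlex-smaller one that covers every vertex
equally often, provided that `c` and `c'` exist as follows: `c'` covers every vertex at least as
often as `c` and contains a member
`T` that is smaller than all members of `c`, and `b` has the same members as `c`. -/
theorem IsPerfectGraph.exists_revLexLT [Finite V] (hG : IsPerfectGraph G)
    {lo : LinearOrder (StableSet G)} (hlo : ∀ S S' : StableSet G, S'.1 ⊂ S.1 → lo.lt S' S)
    {c c' b : StableSet G →₀ ℕ} (hdeg : c.degree = c'.degree)
    (hle : ∀ p, stableCount p c ≤ stableCount p c') {T : StableSet G} (hT : 0 < c' T)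
    (hTlt : ∀ S, 0 < c S → lo.lt T S) (hb : ∀ S, 0 < b S ↔ 0 < c S) :
    ∃ d, revLexLT lo d b ∧ d.degree = b.degree ∧ ∀ p, stableCount p d = stableCount p b := by
  classical
  have hpos : ∀ p, 0 < stableCount p b ↔ 0 < stableCount p c := by
    intro p
    simp only [coverCount_pos_iff, hb]
  -- Trimming `T` to covered vertices makes it possible to subtract it from the counts of `b`, and
  -- only moves it down in the order.
  let T' : StableSet G := ⟨{p ∈ T.1 | 0 < stableCount p c}, T.2.mono fun p hp => hp.1⟩
  have hT' : ∀ S, 0 < b S → lo.lt T' S := by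
    intro S hS
    rcases (show T'.1 ⊆ T.1 from fun p hp => hp.1).eq_or_ssubset with h | h
    · rw [show T' = T from Subtype.ext h]
      exact hTlt S ((hb S).1 hS)
    · exact lt_trans (hlo T T' h) (hTlt S ((hb S).1 hS))
  -- Needed because `b.degree - 1` is a truncated subtraction.
  have hb1 : 1 ≤ b.degree := by
    by_contra hcon
    have hb0 : b = 0 := (Finsupp.degree_eq_zero_iff b).1 (by omega)
    have hc0 : c = 0 := by
      ext S
      have := hb S
      simp only [hb0, Finsupp.coe_zero, Pi.zero_apply] at this ⊢
      omega
    rw [hc0, map_zero] at hdeg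
    rw [(Finsupp.degree_eq_zero_iff c').1 hdeg.symm] at hT
    exact absurd hT (lt_irrefl _)
  let w : V → ℕ := fun p => stableCount p b - if p ∈ T'.1 then 1 else 0
  have hw : ∀ p, w p + (if p ∈ T'.1 then 1 else 0) = stableCount p b := by
    intro p
    by_cases hp : p ∈ T'.1
    · have := (hpos p).2 hp.2
      simp only [w, if_pos hp]
      omega
    · simp [w, hp]
  obtain ⟨d, hd, hdw⟩ := hG.exists_stableCount_eq w (b.degree - 1) (by
    intro C hC
    have h1 := sum_stableCount_le_degree hC b
    have h2 : ∑ p ∈ C, w p ≤ ∑ p ∈ C, stableCount p b :=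
      Finset.sum_le_sum fun p _ => Nat.sub_le _ _
    by_cases heq : ∑ p ∈ C, stableCount p b = b.degree
    -- Tightness passes from `b` to `c`, which has the same members, and then to `c'`, which covers
    -- at least as much with equally many sets. So `T` meets `C`, at a vertex that `c` and `c'`
    -- cover equally often; this vertex survives the trimming.
    · have hbC := (sum_stableCount_eq_degree_iff hC b).1 heq
      have hcC : ∑ p ∈ C, stableCount p c = c.degree :=
        (sum_stableCount_eq_degree_iff hC c).2 fun S hS => hbC S ((hb S).2 hS)
      have hle' : ∑ p ∈ C, stableCount p c ≤ ∑ p ∈ C, stableCount p c' :=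
        Finset.sum_le_sum fun p _ => hle p
      have hc'C : ∑ p ∈ C, stableCount p c' = c'.degree :=
        le_antisymm (sum_stableCount_le_degree hC c') (by omega)
      obtain ⟨p, hp, hpT⟩ := (sum_stableCount_eq_degree_iff hC c').1 hc'C T hT
      have hpc : stableCount p c = stableCount p c' :=
        (Finset.sum_eq_sum_iff_of_le fun p _ => hle p).1 (by omega) p hp
      have hpT' : p ∈ T'.1 := ⟨hpT, by
        rw [hpc]
        exact coverCount_pos_iff.2 ⟨T, hT, hpT⟩⟩
      have h3 : ∑ p ∈ C, w p < ∑ p ∈ C, stableCount p b := by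
        refine Finset.sum_lt_sum (fun q _ => Nat.sub_le _ _) ⟨p, hp, ?_⟩
        have := hw p
        rw [if_pos hpT'] at this
        omega
      omega
    · omega)
  have hdeg' : (d + Finsupp.single T' 1).degree = b.degree := by
    rw [map_add, hd, Finsupp.degree_single]
    omega
  refine ⟨d + Finsupp.single T' 1, ?_, hdeg', fun p => ?_⟩
  · exact revLexLT_of_forall_lt hdeg' (i := T') (by simp) hT'
  · rw [map_add, hdw, coverCount_single]
    convert hw p

end Perfect

/-! ### The toric ideals as kernels of monomial maps -/

section ToricIdeals

variable {V : Type*}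

theorem linearCombination_prod_one {σ M : Type*} [AddCommMonoid M] (ψ : σ → M) (c : σ →₀ ℕ) :
    Finsupp.linearCombination ℕ (fun i => (ψ i, 1) : σ → M × ℕ) c =
      (Finsupp.linearCombination ℕ ψ c, c.degree) := by
  induction c using Finsupp.induction_linear with
  | zero => simp only [map_zero, Prod.mk_zero_zero]
  | add f g hf hg => simp only [map_add, hf, hg, Prod.mk_add_mk]
  | single i n => simp

theorem linearCombination_rho_apply {σ : Type*} (s : σ → Set V) (c : σ →₀ ℕ) (p : V) :
    Finsupp.linearCombination ℕ (fun i => rho ℤ (s i)) c p = (coverCount s p c : ℤ) := by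
  classical
  induction c using Finsupp.induction_linear with
  | zero => simp
  | add f g hf hg => simp only [map_add, Pi.add_apply, hf, hg, Nat.cast_add]
  | single i n => by_cases h : p ∈ s i <;> simp [coverCount_single, rho, h]

theorem stableToricIdeal_eq [Finite V] (K : Type*) [Field K] (G : SimpleGraph V) :
    stableToricIdeal K G =
      monomialKernel K (fun S : StableSet G => ((rho ℤ S.1, 1) : (V → ℤ) × ℕ)) := by
  ext f
  rw [stableToricIdeal, Ideal.mem_comap, toricIdeal, monomialKernel, RingHom.mem_ker,
    RingHom.mem_ker]
  erw [aeval_rename]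
  rfl

theorem cayleyToricIdeal_eq [Finite V] [PartialOrder V] (K : Type*) [Field K] (G : SimpleGraph V) :
    cayleyToricIdeal K G =
      monomialKernel K (fun v : CayleyVar G => ((cayleyPoint v, 1) : (Option V → ℤ) × ℕ)) := by
  ext f
  rw [cayleyToricIdeal, Ideal.mem_comap, toricIdeal, monomialKernel, RingHom.mem_ker,
    RingHom.mem_ker]
  erw [aeval_rename]
  rfl

variable {G : SimpleGraph V}

/-- The exponent of `s` records the number of stable sets, and the exponents of the `t_p` record how
often each vertex is covered. -/
theorem stable_fiber_iff {c d : StableSet G →₀ ℕ} :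
    Finsupp.linearCombination ℕ (fun S : StableSet G => ((rho ℤ S.1, 1) : (V → ℤ) × ℕ)) c =
      Finsupp.linearCombination ℕ (fun S : StableSet G => ((rho ℤ S.1, 1) : (V → ℤ) × ℕ)) d ↔
    c.degree = d.degree ∧ ∀ p, stableCount p c = stableCount p d := by
  rw [linearCombination_prod_one (fun S : StableSet G => rho ℤ S.1),
    linearCombination_prod_one (fun S : StableSet G => rho ℤ S.1), Prod.mk.injEq, and_comm,
    funext_iff]
  refine and_congr_right fun _ => forall_congr' fun p => ?_
  rw [linearCombination_rho_apply (fun S : StableSet G => S.1),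
    linearCombination_rho_apply (fun S : StableSet G => S.1), Nat.cast_inj]

variable [PartialOrder V]

theorem CayleyVar.x_injective : Function.Injective (CayleyVar.x : LowerSet V → CayleyVar G) :=
  fun _ _ h => CayleyVar.x.inj h

/-- The part of an exponent vector that belongs to the variables `x I`. -/
noncomputable def xPart (u : CayleyVar G →₀ ℕ) : LowerSet V →₀ ℕ :=
  u.comapDomain CayleyVar.x CayleyVar.x_injective.injOn

/-- The part of an exponent vector that belongs to the variables `y S`. -/
noncomputable def yPart (u : CayleyVar G →₀ ℕ) : StableSet G →₀ ℕ :=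
  u.comapDomain CayleyVar.y CayleyVar.y_injective.injOn

@[simp]
theorem xPart_apply (u : CayleyVar G →₀ ℕ) (I : LowerSet V) : xPart u I = u (.x I) := rfl

@[simp]
theorem yPart_apply (u : CayleyVar G →₀ ℕ) (S : StableSet G) : yPart u S = u (.y S) := rfl

theorem pos_of_mem_support_xPart {u : CayleyVar G →₀ ℕ} {I : LowerSet V}
    (h : I ∈ (xPart u).support) : 0 < u (.x I) :=
  Nat.pos_of_ne_zero (show xPart u I ≠ 0 from Finsupp.mem_support_iff.1 h)

theorem linearCombination_xPart_add_yPart {M : Type*} [AddCommMonoid M] (φ : CayleyVar G → M)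
    (u : CayleyVar G →₀ ℕ) :
    Finsupp.linearCombination ℕ φ u = Finsupp.linearCombination ℕ (fun I => φ (.x I)) (xPart u) +
      Finsupp.linearCombination ℕ (fun S => φ (.y S)) (yPart u) := by
  have hx : ∀ u v : CayleyVar G →₀ ℕ, xPart (u + v) = xPart u + xPart v := fun _ _ =>
    Finsupp.ext fun _ => rfl
  have hy : ∀ u v : CayleyVar G →₀ ℕ, yPart (u + v) = yPart u + yPart v := fun _ _ =>
    Finsupp.ext fun _ => rfl
  induction u using Finsupp.induction_linear with
  | zero =>
    rw [show xPart (0 : CayleyVar G →₀ ℕ) = 0 from Finsupp.ext fun _ => rfl,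
      show yPart (0 : CayleyVar G →₀ ℕ) = 0 from Finsupp.ext fun _ => rfl]
    simp only [map_zero, add_zero]
  | add u v hu hv => rw [hx, hy, map_add, map_add, map_add, hu, hv, add_add_add_comm]
  | single w n =>
    cases w with
    | x I =>
      have h1 : xPart (Finsupp.single (.x I : CayleyVar G) n) = Finsupp.single I n :=
        Finsupp.comapDomain_single _ _ _ _
      have h2 : yPart (Finsupp.single (.x I : CayleyVar G) n) = 0 := by
        ext S
        simp
      rw [h1, h2]
      simp
    | y S =>
      have h1 : yPart (Finsupp.single (.y S : CayleyVar G) n) = Finsupp.single S n :=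
        Finsupp.comapDomain_single _ _ _ _
      have h2 : xPart (Finsupp.single (.y S : CayleyVar G) n) = 0 := by
        ext S
        simp
      rw [h1, h2]
      simp

/-- How often the poset ideals among the variables contain `p`. -/
noncomputable abbrev idealCount (p : V) : (LowerSet V →₀ ℕ) →+ ℕ :=
  coverCount (fun I : LowerSet V => (I : Set V)) p

theorem degree_xPart_add_degree_yPart (u : CayleyVar G →₀ ℕ) :
    u.degree = (xPart u).degree + (yPart u).degree := by
  have h := linearCombination_xPart_add_yPart (fun _ => (1 : ℕ)) u
  simpa [Finsupp.linearCombination_apply, Finsupp.degree_apply, Finsupp.sum] using h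

theorem linearCombination_cayleyPoint_none (u : CayleyVar G →₀ ℕ) :
    Finsupp.linearCombination ℕ cayleyPoint u none = ((xPart u).degree : ℤ) := by
  rw [linearCombination_xPart_add_yPart]
  simp [Finsupp.linearCombination_apply, Finsupp.degree_apply, Finsupp.sum, cayleyPoint,
    appendCoord]

theorem linearCombination_cayleyPoint_some (u : CayleyVar G →₀ ℕ) (p : V) :
    Finsupp.linearCombination ℕ cayleyPoint u (some p) =
      (idealCount p (xPart u) : ℤ) + stableCount p (yPart u) := by
  rw [linearCombination_xPart_add_yPart, Pi.add_apply,
    ← linearCombination_rho_apply (fun I : LowerSet V => (I : Set V)),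
    ← linearCombination_rho_apply (fun S : StableSet G => S.1)]
  simp [Finsupp.linearCombination_apply, Finsupp.sum, cayleyPoint, appendCoord]

/-- The extra coordinate `t_{d+1}` counts the poset ideals, and `s` counts all factors; together
they fix the number of stable sets as well. -/
theorem cayley_fiber_iff {u v : CayleyVar G →₀ ℕ} :
    Finsupp.linearCombination ℕ
        (fun w : CayleyVar G => ((cayleyPoint w, 1) : (Option V → ℤ) × ℕ)) u =
      Finsupp.linearCombination ℕ
        (fun w : CayleyVar G => ((cayleyPoint w, 1) : (Option V → ℤ) × ℕ)) v ↔
    (xPart u).degree = (xPart v).degree ∧ (yPart u).degree = (yPart v).degree ∧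
      ∀ p, idealCount p (xPart u) + stableCount p (yPart u) =
        idealCount p (xPart v) + stableCount p (yPart v) := by
  rw [linearCombination_prod_one (fun w : CayleyVar G => cayleyPoint w),
    linearCombination_prod_one (fun w : CayleyVar G => cayleyPoint w), Prod.mk.injEq, funext_iff,
    Option.forall, linearCombination_cayleyPoint_none, linearCombination_cayleyPoint_none,
    degree_xPart_add_degree_yPart, degree_xPart_add_degree_yPart]
  simp only [linearCombination_cayleyPoint_some]
  norm_cast
  constructor
  · rintro ⟨⟨h1, h2⟩, h3⟩
    exact ⟨h1, by omega, h2⟩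
  · rintro ⟨h1, h2, h3⟩
    exact ⟨⟨h1, h3⟩, by omega⟩

end ToricIdeals

/-! ### The initial ideals -/

section Initial

variable {V : Type*} [Finite V] {G : SimpleGraph V} {K : Type*} [Field K]

theorem mem_initialExponents_stableToricIdeal {lo : LinearOrder (StableSet G)}
    {c : StableSet G →₀ ℕ} :
    c ∈ initialExponents (revLexOrder lo) (stableToricIdeal K G) ↔ ∃ d, revLexLT lo d c ∧
      d.degree = c.degree ∧ ∀ p, stableCount p d = stableCount p c := by
  rw [stableToricIdeal_eq, mem_initialExponents_monomialKernel]
  simp only [stable_fiber_iff]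
  rfl

/-- The initial ideal of the toric ideal of the stable set polytope of a perfect graph is
radical. -/
theorem IsPerfectGraph.mem_initialExponents_of_support (hG : IsPerfectGraph G)
    {lo : LinearOrder (StableSet G)} (hlo : ∀ S S' : StableSet G, S'.1 ⊂ S.1 → lo.lt S' S)
    {c b : StableSet G →₀ ℕ} (hc : c ∈ initialExponents (revLexOrder lo) (stableToricIdeal K G))
    (hb : ∀ S, 0 < c S → 0 < b S) :
    b ∈ initialExponents (revLexOrder lo) (stableToricIdeal K G) := by
  classical
  obtain ⟨d, hd, hdeg, hcount⟩ := mem_initialExponents_stableToricIdeal.1 hc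
  obtain ⟨T, hT, hTlt⟩ := exists_forall_lt_of_revLexLT hdeg hd
  have hsum : c - d + d = d - c + c := by
    ext S
    simp only [Finsupp.add_apply, Finsupp.tsub_apply]
    omega
  -- Only the members left after cancelling the common factors of `c` and `d` take part in the
  -- exchange; `b'` divides `b`, so it suffices that `b'` is initial.
  let b' : StableSet G →₀ ℕ := b.filter fun S => 0 < (c - d) S
  have hb' : ∀ S, 0 < b' S ↔ 0 < (c - d) S := by
    intro S
    by_cases h : 0 < (c - d) S
    · have h' : 0 < c S := by
        rw [Finsupp.tsub_apply] at h
        omega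
      rw [show b' S = b S from Finsupp.filter_apply_pos _ _ h]
      exact iff_of_true (hb S h') h
    · rw [show b' S = 0 from Finsupp.filter_apply_neg _ _ h]
      exact iff_of_false (lt_irrefl 0) h
  obtain ⟨e, he⟩ := hG.exists_revLexLT hlo (c := c - d) (c' := d - c) (b := b')
    (by
      have := congrArg Finsupp.degree hsum
      rw [map_add, map_add] at this
      omega)
    (fun p => by
      have := congrArg (stableCount p) hsum
      rw [map_add, map_add, hcount p] at this
      omega) hT hTlt hb'
  refine initialExponents_mono _ (c := b') (fun S => ?_)
    (mem_initialExponents_stableToricIdeal.2 ⟨e, he⟩)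
  by_cases h : 0 < (c - d) S
  · simp only [b', Finsupp.filter_apply, if_pos h, le_refl]
  · simp only [b', Finsupp.filter_apply, if_neg h, Nat.zero_le]

variable [PartialOrder V]

/-- The exponents of the initial monomials of the Hibi binomials and the mixed binomials. -/
def hibiMixedExponents (G : SimpleGraph V) : Set (CayleyVar G →₀ ℕ) :=
  {c | (∃ I J : LowerSet V, ¬ (I : Set V) ⊆ J ∧ ¬ (J : Set V) ⊆ I ∧
      c = Finsupp.single (.x I) 1 + Finsupp.single (.x J) 1) ∨
    ∃ (I I' : LowerSet V) (S : StableSet G) (s : V), s ∈ S.1 \ (I : Set V) ∧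
      (I' : Set V) = (I : Set V) ∪ {s} ∧ c = Finsupp.single (.x I) 1 + Finsupp.single (.y S) 1}

theorem single_add_single_le {σ : Type*} {i j : σ} (hij : i ≠ j) {u : σ →₀ ℕ} (hi : 0 < u i)
    (hj : 0 < u j) : Finsupp.single i 1 + Finsupp.single j 1 ≤ u := by
  classical
  intro k
  rw [Finsupp.add_apply, Finsupp.single_apply, Finsupp.single_apply]
  split_ifs with h1 h2 h2
  · exact absurd (h1.trans h2.symm) hij
  · subst h1; exact hi
  · subst h2; exact hj
  · exact Nat.zero_le _

/-- The poset ideals of a monomial without Hibi or mixed divisors cover every element at least as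
often as those of any monomial with the same image. -/
theorem idealCount_le_of_fiber {u v : CayleyVar G →₀ ℕ}
    (hu : ∀ c ∈ hibiMixedExponents G, ¬ c ≤ u) (hdeg : (xPart u).degree = (xPart v).degree)
    (hcount : ∀ p, idealCount p (xPart u) + stableCount p (yPart u) =
        idealCount p (xPart v) + stableCount p (yPart v)) (p : V) :
    idealCount p (xPart v) ≤ idealCount p (xPart u) := by
  classical
  induction p using WellFoundedLT.induction with
  | _ p ih =>
  have hchain : ∀ I J : LowerSet V, 0 < u (.x I) → 0 < u (.x J) →
      (I : Set V) ⊆ J ∨ (J : Set V) ⊆ I := by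
    intro I J hI hJ
    by_contra! hcon
    refine hu _ (Or.inl ⟨I, J, hcon.1, hcon.2, rfl⟩) (single_add_single_le ?_ hI hJ)
    rintro h
    exact hcon.1 (CayleyVar.x_injective h ▸ subset_rfl)
  by_cases hg : 0 < stableCount p (yPart u)
  · obtain ⟨S, hS, hpS⟩ := coverCount_pos_iff.1 hg
    -- If all ideals of `u` contain `p`, the count is the number of ideals, which is the same for
    -- `v` and bounds its count.
    by_cases hall : ∀ I : LowerSet V, 0 < u (.x I) → p ∈ I
    · have h1 : idealCount p (xPart u) = (xPart u).degree := by
        rw [idealCount, coverCount_eq_sum, Finsupp.degree_apply]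
        refine Finset.sum_congr rfl fun I hI => if_pos (hall I (pos_of_mem_support_xPart hI))
      rw [h1, hdeg, idealCount, coverCount_eq_sum, Finsupp.degree_apply]
      refine Finset.sum_le_sum fun I hI => ?_
      split_ifs
      · exact le_rfl
      · exact Nat.zero_le _
    · have hne : {I ∈ (xPart u).support | p ∉ I}.Nonempty := by
        push Not at hall
        obtain ⟨I, hI, hpI⟩ := hall
        exact ⟨I, Finset.mem_filter.2 ⟨Finsupp.mem_support_iff.2 hI.ne', hpI⟩⟩
      -- Take the largest ideal of `u` missing `p`. As no mixed divisor exists, `p` cannot be added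
      -- to it, so it also misses some `q < p`.
      obtain ⟨I, hI, hmax⟩ := Finset.exists_maximal hne
      rw [Finset.mem_filter, Finsupp.mem_support_iff] at hI
      have hIu : 0 < u (.x I) := Nat.pos_of_ne_zero hI.1
      obtain ⟨q, hqp, hqI⟩ : ∃ q, q < p ∧ q ∉ I := by
        by_contra! hcon
        let I' : LowerSet V := ⟨(I : Set V) ∪ {p}, by
          rintro r s hsr (hr | hr)
          · exact Or.inl (I.lower hsr hr)
          · rw [Set.mem_singleton_iff] at hr
            subst hr
            rcases hsr.lt_or_eq with h | h
            · exact Or.inl (hcon s h)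
            · exact Or.inr h⟩
        exact hu _ (Or.inr ⟨I, I', S, p, ⟨hpS, hI.2⟩, rfl, rfl⟩)
          (single_add_single_le (by simp) hIu hS)
      -- An ideal of the chain containing `q` is strictly larger than `I`, hence contains `p` by
      -- maximality. For `v`, down-closedness gives the opposite comparison of `p` and `q`, and
      -- induction at `q` links the two.
      have h1 : idealCount q (xPart u) ≤ idealCount p (xPart u) := by
        rw [idealCount, idealCount, coverCount_eq_sum, coverCount_eq_sum]
        refine Finset.sum_le_sum fun J hJ => ?_
        by_cases hq : q ∈ (J : Set V)
        · rw [if_pos hq, if_pos]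
          by_contra hp
          have hJu : 0 < u (.x J) := pos_of_mem_support_xPart hJ
          rcases hchain I J hIu hJu with h | h
          · exact hqI (hmax (Finset.mem_filter.2 ⟨hJ, hp⟩) h hq)
          · exact hqI (h hq)
        · rw [if_neg hq]
          exact Nat.zero_le _
      have h2 : idealCount p (xPart v) ≤ idealCount q (xPart v) := by
        rw [idealCount, idealCount, coverCount_eq_sum, coverCount_eq_sum]
        refine Finset.sum_le_sum fun J hJ => ?_
        by_cases hp : p ∈ (J : Set V)
        · rw [if_pos hp, if_pos (J.lower hqp.le hp)]
        · rw [if_neg hp]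
          exact Nat.zero_le _
      exact (h2.trans (ih q hqp)).trans h1
  -- No stable set of `u` contains `p`, so the ideals of `u` carry the whole count.
  · have := hcount p
    omega

/-- A monomial of the initial ideal of the Cayley sum is divisible by the initial monomial of a Hibi
or mixed binomial, or its `y`-part is in the initial ideal of the stable set polytope. -/
theorem IsPerfectGraph.hibiMixed_or_yPart_mem_initialExponents (hG : IsPerfectGraph G)
    {lo : LinearOrder (CayleyVar G)} (hlo : IsCompatibleOrder lo) {u : CayleyVar G →₀ ℕ}
    (hu : u ∈ initialExponents (revLexOrder lo) (cayleyToricIdeal K G)) :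
    (∃ c ∈ hibiMixedExponents G, c ≤ u) ∨
      yPart u ∈ initialExponents (revLexOrder (restrictOrder lo)) (stableToricIdeal K G) := by
  classical
  rw [or_iff_not_imp_left]
  intro hno
  push Not at hno
  rw [cayleyToricIdeal_eq, mem_initialExponents_monomialKernel] at hu
  obtain ⟨v, hvu, hfib⟩ := hu
  have hdeg : v.degree = u.degree := by
    have := congrArg Prod.snd hfib
    rwa [linearCombination_prod_one (fun w : CayleyVar G => cayleyPoint w),
      linearCombination_prod_one (fun w : CayleyVar G => cayleyPoint w)] at this
  obtain ⟨i, hi, hlt⟩ := exists_forall_lt_of_revLexLT hdeg hvu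
  -- Images lie in a cancellative monoid, so cancelling common factors keeps the two monomials in
  -- one fibre.
  have hfib' : Finsupp.linearCombination ℕ
        (fun w : CayleyVar G => ((cayleyPoint w, 1) : (Option V → ℤ) × ℕ)) (u - v) =
      Finsupp.linearCombination ℕ
        (fun w : CayleyVar G => ((cayleyPoint w, 1) : (Option V → ℤ) × ℕ)) (v - u) := by
    have hsum : u - v + v = v - u + u := by
      ext w
      simp only [Finsupp.add_apply, Finsupp.tsub_apply]
      omega
    have := congrArg (Finsupp.linearCombination ℕ
        (fun w : CayleyVar G => ((cayleyPoint w, 1) : (Option V → ℤ) × ℕ))) hsum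
    rw [map_add, map_add, hfib] at this
    exact add_right_cancel this
  obtain ⟨hx, hy, hcount⟩ := cayley_fiber_iff.1 hfib'
  have hno' : ∀ c ∈ hibiMixedExponents G, ¬ c ≤ u - v := fun c hc h =>
    hno c hc (h.trans tsub_le_self)
  have hh := idealCount_le_of_fiber hno' hx hcount
  cases i with
  | x I' =>
    exfalso
    -- Every variable of `u - v` exceeds `x I'`, which excludes the `y` variables.
    have hy0 : yPart (u - v) = 0 := by
      ext S
      by_contra hne
      exact lt_asymm (hlt _ (Nat.pos_of_ne_zero hne)) (hlo.y_lt_x S I')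
    have hxne : (xPart (u - v)).support.Nonempty := by
      rw [Finsupp.support_nonempty_iff]
      intro h0
      rw [h0, map_zero] at hx
      have := (Finsupp.degree_eq_zero_iff _).1 hx.symm
      have h1 : xPart (v - u) I' = 0 := by rw [this]; rfl
      exact hi.ne' h1
    obtain ⟨I, hI, hmax⟩ := Finset.exists_maximal hxne
    have hIu : 0 < (u - v) (.x I) := pos_of_mem_support_xPart hI
    -- Each point of `I'` is covered by an ideal of `u - v`; these form a chain with top `I`.
    have hsub : (I' : Set V) ⊆ I := by
      intro p hp
      have h1 : 0 < idealCount p (xPart (v - u)) := coverCount_pos_iff.2 ⟨I', hi, hp⟩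
      obtain ⟨J, hJ, hpJ⟩ := coverCount_pos_iff.1 (h1.trans_le (hh p))
      by_cases hIJ : (I : Set V) ⊆ J
      · exact hmax (Finsupp.mem_support_iff.2 hJ.ne') hIJ hpJ
      · by_cases hJI : (J : Set V) ⊆ I
        · exact hJI hpJ
        · refine absurd (single_add_single_le (fun h => hIJ ?_) hIu hJ)
            (hno' _ (Or.inl ⟨I, J, hIJ, hJI, rfl⟩))
          rw [CayleyVar.x_injective h]
    have hlt' := hlt _ hIu
    rcases hsub.eq_or_ssubset with h | h
    · rw [SetLike.coe_injective h] at hlt'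
      exact lt_irrefl _ hlt'
    · exact lt_asymm hlt' (hlo.x_lt_x I' I h)
  | y T =>
    -- Total counts agree and the ideals of `u - v` cover at least as much, so its stable sets cover
    -- at most as much as those of `v - u`.
    obtain ⟨d, hd⟩ := hG.exists_revLexLT (lo := restrictOrder lo) (fun S S' h => hlo.y_lt_y S S' h)
      (c := yPart (u - v)) (c' := yPart (v - u)) (b := yPart (u - v)) hy
      (fun p => by
        have := hcount p
        have := hh p
        omega) (T := T) hi (fun S hS => hlt _ hS) fun _ => Iff.rfl
    exact initialExponents_mono _ (fun S => tsub_le_self (a := u (.y S)) (b := v (.y S)))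
      (mem_initialExponents_stableToricIdeal.2 ⟨d, hd⟩)

end Initial

/-! ### The binomials and the restriction to the variables `y S` -/

section MapDomain

variable {V : Type*} [PartialOrder V] {G : SimpleGraph V}

theorem revLexLT_mapDomain_y {lo : LinearOrder (CayleyVar G)} {a b : StableSet G →₀ ℕ}
    (h : revLexLT (restrictOrder lo) a b) :
    revLexLT lo (a.mapDomain CayleyVar.y) (b.mapDomain CayleyVar.y) := by
  rw [revLexLT, Finsupp.degree_mapDomain, Finsupp.degree_mapDomain]
  refine h.imp_right fun ⟨hdeg, S, hS, hlt⟩ => ⟨hdeg, .y S, fun j hj => ?_, ?_⟩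
  · cases j with
    | x I =>
      rw [Finsupp.mapDomain_of_notMem_range _ _ (by simp), Finsupp.mapDomain_of_notMem_range _ _ (by simp)]
    | y T =>
      rw [Finsupp.mapDomain_apply CayleyVar.y_injective,
        Finsupp.mapDomain_apply CayleyVar.y_injective]
      exact hS T hj
  · rwa [Finsupp.mapDomain_apply CayleyVar.y_injective,
      Finsupp.mapDomain_apply CayleyVar.y_injective]

theorem mapDomain_y_le {u : CayleyVar G →₀ ℕ} {c : StableSet G →₀ ℕ} (h : c ≤ yPart u) :
    c.mapDomain CayleyVar.y ≤ u := by
  intro v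
  cases v with
  | x I =>
    rw [Finsupp.mapDomain_of_notMem_range _ _ (by simp)]
    exact Nat.zero_le _
  | y S =>
    rw [Finsupp.mapDomain_apply CayleyVar.y_injective]
    exact h S

end MapDomain

section Binomials

variable {V : Type*} [Finite V] [PartialOrder V] {G : SimpleGraph V} {K : Type*} [Field K]

theorem X_mul_X_eq_monomial {σ : Type*} (i j : σ) :
    (X i * X j : MvPolynomial σ K) = monomial (Finsupp.single i 1 + Finsupp.single j 1) 1 := by
  rw [X, X, monomial_mul, one_mul]

theorem revLexLT_single_add_single {σ : Type*} {lo : LinearOrder σ} {i j k l : σ}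
    (hi : lo.lt i k) (hj : lo.lt i l) :
    revLexLT lo (Finsupp.single i 1 + Finsupp.single j 1)
      (Finsupp.single k 1 + Finsupp.single l 1) := by
  classical
  refine revLexLT_of_forall_lt (by simp) (i := i) (by simp) fun n hn => ?_
  rw [Finsupp.add_apply, Finsupp.single_apply, Finsupp.single_apply] at hn
  split_ifs at hn with h1 h2 h2
  · exact h1 ▸ hi
  · exact h1 ▸ hi
  · exact h2 ▸ hj
  · exact absurd hn (lt_irrefl _)

theorem single_add_single_le_one {σ : Type*} {i j : σ} (hij : i ≠ j) (k : σ) :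
    (Finsupp.single i 1 + Finsupp.single j 1 : σ →₀ ℕ) k ≤ 1 := by
  classical
  rw [Finsupp.add_apply, Finsupp.single_apply, Finsupp.single_apply]
  split_ifs with h1 h2 h2
  · exact absurd (h1.trans h2.symm) hij
  all_goals decide

/-- The Hibi and mixed binomials belong to the toric ideal, and their initial monomial is the first
one. -/
theorem binomial_mem_and_degree {lo : LinearOrder (CayleyVar G)} {i j k l : CayleyVar G}
    (hik : lo.lt k i) (hjk : lo.lt k j)
    (h : cayleyPoint i + cayleyPoint j = cayleyPoint l + cayleyPoint k) :
    (X i * X j - X l * X k : MvPolynomial (CayleyVar G) K) ∈ cayleyToricIdeal K G ∧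
      (X i * X j - X l * X k : MvPolynomial (CayleyVar G) K) ≠ 0 ∧
      (revLexOrder lo).degree (X i * X j - X l * X k : MvPolynomial (CayleyVar G) K) =
        Finsupp.single i 1 + Finsupp.single j 1 := by
  rw [X_mul_X_eq_monomial, X_mul_X_eq_monomial, cayleyToricIdeal_eq]
  -- The variable `k` is smaller than both factors of the first monomial, which decides the
  -- comparison whatever `l` is.
  have hlt : (revLexOrder lo).toSyn (Finsupp.single l 1 + Finsupp.single k 1) <
      (revLexOrder lo).toSyn (Finsupp.single i 1 + Finsupp.single j 1) := by
    rw [add_comm (Finsupp.single l 1)]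
    exact revLexLT_single_add_single hik hjk
  refine ⟨monomial_sub_monomial_mem_monomialKernel ?_, monomial_sub_monomial_ne_zero hlt,
    degree_monomial_sub_monomial hlt⟩
  simp only [map_add, Finsupp.linearCombination_single, one_smul, Prod.mk_add_mk, h]

/-- The deciding variable is that of `I ⊔ J`, the larger ideal being the smaller variable. -/
theorem hibiBinomial_mem_and_degree {lo : LinearOrder (CayleyVar G)} (hlo : IsCompatibleOrder lo)
    {I J : LowerSet V} (hIJ : ¬ (I : Set V) ⊆ J) (hJI : ¬ (J : Set V) ⊆ I) :
    (X (.x I) * X (.x J) - X (.x (I ⊓ J)) * X (.x (I ⊔ J)) : MvPolynomial (CayleyVar G) K) ∈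
        cayleyToricIdeal K G ∧
      (X (.x I) * X (.x J) - X (.x (I ⊓ J)) * X (.x (I ⊔ J)) : MvPolynomial (CayleyVar G) K) ≠ 0 ∧
      (revLexOrder lo).degree
        (X (.x I) * X (.x J) - X (.x (I ⊓ J)) * X (.x (I ⊔ J)) : MvPolynomial (CayleyVar G) K) =
        Finsupp.single (.x I) 1 + Finsupp.single (.x J) 1 := by
  refine binomial_mem_and_degree (hlo.x_lt_x _ _ ?_) (hlo.x_lt_x _ _ ?_) ?_
  · exact ⟨fun p hp => Or.inl hp, fun h => hJI fun p hp => h (Or.inr hp)⟩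
  · exact ⟨fun p hp => Or.inr hp, fun h => hIJ fun p hp => h (Or.inl hp)⟩
  · funext o
    cases o with
    | none => rfl
    | some p =>
      by_cases h1 : p ∈ I <;> by_cases h2 : p ∈ J <;>
        simp [cayleyPoint, appendCoord, rho, h1, h2]

/-- The deciding variable is that of `S.erase s`: it lies below every `x`, and below `y S` because a
vertex was removed. -/
theorem mixedBinomial_mem_and_degree {lo : LinearOrder (CayleyVar G)} (hlo : IsCompatibleOrder lo)
    {I I' : LowerSet V} {S : StableSet G} {s : V} (hs : s ∈ S.1 \ (I : Set V))
    (hI' : (I' : Set V) = (I : Set V) ∪ {s}) :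
    (X (.x I) * X (.y S) - X (.x I') * X (.y (S.erase s)) : MvPolynomial (CayleyVar G) K) ∈
        cayleyToricIdeal K G ∧
      (X (.x I) * X (.y S) - X (.x I') * X (.y (S.erase s)) : MvPolynomial (CayleyVar G) K) ≠ 0 ∧
      (revLexOrder lo).degree
        (X (.x I) * X (.y S) - X (.x I') * X (.y (S.erase s)) : MvPolynomial (CayleyVar G) K) =
        Finsupp.single (.x I) 1 + Finsupp.single (.y S) 1 := by
  refine binomial_mem_and_degree (hlo.y_lt_x _ _) (hlo.y_lt_y _ _ ?_) ?_
  · exact ⟨Set.sdiff_subset, fun h => (h hs.1).2 rfl⟩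
  · funext o
    cases o with
    | none => rfl
    | some p =>
      have hp : p ∈ I' ↔ p ∈ I ∨ p = s := by
        rw [← SetLike.mem_coe, hI']
        rfl
      have hsI : s ∉ I := hs.2
      have hsS : s ∈ S.1 := hs.1
      by_cases h0 : p = s
      · subst h0
        simp [cayleyPoint, appendCoord, rho, StableSet.erase, hp, hsI, hsS]
      · by_cases h1 : p ∈ I <;> by_cases h2 : p ∈ S.1 <;>
          simp [cayleyPoint, appendCoord, rho, StableSet.erase, hp, h0, h1, h2]

theorem exists_hibiMixed_degree_eq {lo : LinearOrder (CayleyVar G)} (hlo : IsCompatibleOrder lo)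
    {c : CayleyVar G →₀ ℕ} (hc : c ∈ hibiMixedExponents G) :
    ∃ g ∈ hibiBinomials K G ∪ mixedBinomials K G, (revLexOrder lo).degree g = c := by
  rcases hc with ⟨I, J, hIJ, hJI, rfl⟩ | ⟨I, I', S, s, hs, hI', rfl⟩
  · exact ⟨_, Or.inl ⟨I, J, hIJ, hJI, rfl⟩, (hibiBinomial_mem_and_degree hlo hIJ hJI).2.2⟩
  · exact ⟨_, Or.inr ⟨I, I', S, s, hs, hI', rfl⟩, (mixedBinomial_mem_and_degree hlo hs hI').2.2⟩

theorem hibiMixed_mem_and_ne_zero {lo : LinearOrder (CayleyVar G)} (hlo : IsCompatibleOrder lo)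
    {g : MvPolynomial (CayleyVar G) K} (hg : g ∈ hibiBinomials K G ∪ mixedBinomials K G) :
    g ∈ cayleyToricIdeal K G ∧ g ≠ 0 := by
  rcases hg with ⟨I, J, hIJ, hJI, rfl⟩ | ⟨I, I', S, s, hs, hI', rfl⟩
  · have h := hibiBinomial_mem_and_degree (K := K) hlo hIJ hJI
    exact ⟨h.1, h.2.1⟩
  · have h := mixedBinomial_mem_and_degree (K := K) hlo hs hI'
    exact ⟨h.1, h.2.1⟩

theorem finite_hibiBinomials_union_mixedBinomials :
    (hibiBinomials K G ∪ mixedBinomials K G).Finite := by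
  have : Finite (LowerSet V) := Finite.of_injective _ SetLike.coe_injective
  refine Set.Finite.union ?_ ?_
  · refine (Set.finite_range fun p : LowerSet V × LowerSet V => (X (.x p.1) * X (.x p.2) -
      X (.x (p.1 ⊓ p.2)) * X (.x (p.1 ⊔ p.2)) : MvPolynomial (CayleyVar G) K)).subset ?_
    rintro _ ⟨I, J, -, -, rfl⟩
    exact ⟨(I, J), rfl⟩
  · refine (Set.finite_range fun p : LowerSet V × LowerSet V × StableSet G × V =>
      (X (.x p.1) * X (.y p.2.2.1) - X (.x p.2.1) * X (.y (p.2.2.1.erase p.2.2.2)) :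
        MvPolynomial (CayleyVar G) K)).subset ?_
    rintro _ ⟨I, I', S, s, -, -, rfl⟩
    exact ⟨(I, I', S, s), rfl⟩

theorem rename_y_mem_cayleyToricIdeal {f : MvPolynomial (StableSet G) K}
    (hf : f ∈ stableToricIdeal K G) :
    rename CayleyVar.y f ∈ cayleyToricIdeal K G := by
  rw [stableToricIdeal_eq, monomialKernel, RingHom.mem_ker] at hf
  rw [cayleyToricIdeal_eq, monomialKernel, RingHom.mem_ker, aeval_rename]
  -- Stable sets sit at height 0 in the Cayley sum, so the map on the `y` variables factors through
  -- the stable set map followed by `φ`.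
  let φ : (V → ℤ) × ℕ →+ (Option V → ℤ) × ℕ :=
    { toFun := fun a => (appendCoord a.1 0, a.2)
      map_zero' := by
        ext o
        · cases o <;> rfl
        · rfl
      map_add' := fun a b => by
        ext o
        · cases o <;> rfl
        · rfl }
  have h : aeval (R := K) ((fun v : CayleyVar G =>
        (AddMonoidAlgebra.single (cayleyPoint v, 1) 1 :
          AddMonoidAlgebra K ((Option V → ℤ) × ℕ))) ∘ CayleyVar.y) =
      (AddMonoidAlgebra.mapDomainAlgHom K K φ).comp (aeval fun S : StableSet G =>
        (AddMonoidAlgebra.single (rho ℤ S.1, 1) 1 : AddMonoidAlgebra K ((V → ℤ) × ℕ))) := by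
    refine MvPolynomial.algHom_ext fun S => ?_
    rw [AlgHom.comp_apply, aeval_X, aeval_X]
    simp [φ, cayleyPoint]
  rw [show (aeval ((fun v : CayleyVar G => (AddMonoidAlgebra.single (cayleyPoint v, 1) 1 :
    AddMonoidAlgebra K ((Option V → ℤ) × ℕ))) ∘ CayleyVar.y)) f = _ from DFunLike.congr_fun h f,
    AlgHom.comp_apply]
  erw [hf]
  exact map_zero _

/-- Renaming is injective on monomials and preserves their order, so it carries the largest one to
the largest one. -/
theorem degree_rename_y {lo : LinearOrder (CayleyVar G)} {f : MvPolynomial (StableSet G) K}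
    (hf : f ≠ 0) : (revLexOrder lo).degree (rename CayleyVar.y f) =
      ((revLexOrder (restrictOrder lo)).degree f).mapDomain CayleyVar.y := by
  classical
  have hne : rename CayleyVar.y f ≠ (0 : MvPolynomial (CayleyVar G) K) := by
    rw [Ne, ← map_zero (rename (R := K) (CayleyVar.y : StableSet G → CayleyVar G))]
    exact fun h => hf (rename_injective _ CayleyVar.y_injective h)
  have hsupp := (revLexOrder lo).degree_mem_support hne
  have hmem : ((revLexOrder (restrictOrder lo)).degree f).mapDomain CayleyVar.y ∈
      (rename CayleyVar.y f : MvPolynomial (CayleyVar G) K).support := by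
    rw [support_rename_of_injective CayleyVar.y_injective]
    exact Finset.mem_image_of_mem _ (MonomialOrder.degree_mem_support hf)
  rw [support_rename_of_injective CayleyVar.y_injective, Finset.mem_image] at hsupp
  obtain ⟨b, hb, hbeq⟩ := hsupp
  by_contra hcon
  have hb' : b ≠ (revLexOrder (restrictOrder lo)).degree f := by
    rintro rfl
    exact hcon hbeq.symm
  have h1 : revLexLT lo (b.mapDomain CayleyVar.y)
      (((revLexOrder (restrictOrder lo)).degree f).mapDomain CayleyVar.y) :=
    revLexLT_mapDomain_y (MonomialOrder.lt_of_mem_support hb hb')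
  rw [hbeq] at h1
  exact absurd ((revLexOrder lo).le_degree hmem) (not_le.2 h1)

theorem mapDomain_y_mem_initialExponents {lo : LinearOrder (CayleyVar G)} {c : StableSet G →₀ ℕ}
    (hc : c ∈ initialExponents (revLexOrder (restrictOrder lo)) (stableToricIdeal K G)) :
    c.mapDomain CayleyVar.y ∈ initialExponents (revLexOrder lo) (cayleyToricIdeal K G) := by
  obtain ⟨f, hf, h0, rfl⟩ := hc
  refine ⟨_, rename_y_mem_cayleyToricIdeal hf, fun h => h0 ?_, degree_rename_y h0⟩
  exact rename_injective _ CayleyVar.y_injective (h.trans (map_zero _).symm)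

end Binomials

/-! ### The main theorem -/

section Main

variable {V : Type*} [Finite V] [PartialOrder V] {G : SimpleGraph V} {K : Type*} [Field K]

theorem IsPerfectGraph.isGroebnerBasis_cayleyToricIdeal (hG : IsPerfectGraph G)
    {lo : LinearOrder (CayleyVar G)} (hlo : IsCompatibleOrder lo)
    {𝒢 : Set (MvPolynomial (StableSet G) K)}
    (h𝒢 : IsGroebnerBasis (revLexOrder (restrictOrder lo)) 𝒢 (stableToricIdeal K G)) :
    IsGroebnerBasis (revLexOrder lo)
      (hibiBinomials K G ∪ rename CayleyVar.y '' 𝒢 ∪ mixedBinomials K G)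
      (cayleyToricIdeal K G) := by
  rw [Set.union_right_comm]
  refine isGroebnerBasis_of_exists_degree_le
    (finite_hibiBinomials_union_mixedBinomials.union (h𝒢.finite.image _)) ?_ ?_ ?_
  · rintro _ (hg | ⟨g, hg, rfl⟩)
    · exact (hibiMixed_mem_and_ne_zero hlo hg).1
    · exact rename_y_mem_cayleyToricIdeal (h𝒢.subset hg)
  · rintro _ (hg | ⟨g, hg, rfl⟩)
    · exact (hibiMixed_mem_and_ne_zero hlo hg).2
    · exact fun h => h𝒢.ne_zero g hg
        (rename_injective _ CayleyVar.y_injective (h.trans (map_zero _).symm))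
  · intro u hu
    rcases hG.hibiMixed_or_yPart_mem_initialExponents hlo hu with ⟨c, hc, hle⟩ | hy
    · obtain ⟨g, hg, rfl⟩ := exists_hibiMixed_degree_eq (K := K) hlo hc
      exact ⟨g, Or.inl hg, hle⟩
    · obtain ⟨g, hg, hle⟩ := h𝒢.exists_degree_le hy
      refine ⟨_, Or.inr ⟨g, hg, rfl⟩, ?_⟩
      rw [degree_rename_y (h𝒢.ne_zero g hg)]
      exact mapDomain_y_le hle

theorem IsPerfectGraph.isSquarefree_initialIdeal_cayleyToricIdeal (hG : IsPerfectGraph G)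
    {lo : LinearOrder (CayleyVar G)} (hlo : IsCompatibleOrder lo) :
    IsSquarefreeMonomialIdeal (initialIdeal (revLexOrder lo) (cayleyToricIdeal K G)) := by
  refine ⟨{c | c ∈ initialExponents (revLexOrder lo) (cayleyToricIdeal K G) ∧ ∀ i, c i ≤ 1},
    fun c hc => hc.2, ?_⟩
  rw [initialIdeal_eq]
  refine le_antisymm (Ideal.span_le.2 ?_)
    (Ideal.span_mono (Set.image_mono fun c hc => hc.1))
  rintro _ ⟨u, hu, rfl⟩
  refine (mem_span_monomial_iff _ _).2 ?_
  rcases hG.hibiMixed_or_yPart_mem_initialExponents hlo hu with ⟨c, hc, hle⟩ | hy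
  · refine ⟨c, ⟨?_, ?_⟩, hle⟩
    · obtain ⟨g, hg, rfl⟩ := exists_hibiMixed_degree_eq (K := K) hlo hc
      have h := hibiMixed_mem_and_ne_zero hlo hg
      exact ⟨g, h.1, h.2, rfl⟩
    · rcases hc with ⟨I, J, hIJ, -, rfl⟩ | ⟨I, I', S, s, -, -, rfl⟩
      · exact single_add_single_le_one fun h => hIJ (CayleyVar.x_injective h ▸ subset_rfl)
      · exact single_add_single_le_one (by simp)
  -- Capping exponents at 1 keeps the support, so by radicality the capped monomial is still
  -- initial, and it divides `u`.
  · let b : StableSet G →₀ ℕ := (yPart u).mapRange (min 1) (by simp)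
    have hb : ∀ S, b S = min 1 (yPart u S) := fun S => Finsupp.mapRange_apply
    refine ⟨b.mapDomain CayleyVar.y, ⟨mapDomain_y_mem_initialExponents
      (hG.mem_initialExponents_of_support (fun S S' h => hlo.y_lt_y S S' h) hy fun S hS => ?_),
      fun v => ?_⟩, mapDomain_y_le fun S => ?_⟩
    · rw [hb]
      omega
    · cases v with
      | x I =>
        rw [Finsupp.mapDomain_of_notMem_range _ _ (by simp)]
        exact Nat.zero_le _
      | y S =>
        rw [Finsupp.mapDomain_apply CayleyVar.y_injective, hb]
        exact min_le_left _ _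
    · rw [hb]
      exact min_le_right _ _

end Main

/-- The equivalence over all `B` expresses that the reduced Gröbner basis exists and is unique, so
the second clause concerns exactly that basis. -/
theorem theorem2p2 {V : Type*} [Finite V] [PartialOrder V] (G : SimpleGraph V)
    (hG : IsPerfectGraph G) (K : Type*) [Field K]
    (lo : LinearOrder (CayleyVar G)) (hlo : IsCompatibleOrder lo) :
    (∃ 𝒢G : Set (MvPolynomial (StableSet G) K),
      (∀ B : Set (MvPolynomial (StableSet G) K),
        IsReducedGroebnerBasis (revLexOrder (restrictOrder lo)) B (stableToricIdeal K G) ↔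
          B = 𝒢G) ∧
      IsGroebnerBasis (revLexOrder lo)
        (hibiBinomials K G ∪ MvPolynomial.rename CayleyVar.y '' 𝒢G ∪ mixedBinomials K G)
        (cayleyToricIdeal K G)) ∧
    IsSquarefreeMonomialIdeal (initialIdeal (revLexOrder lo) (cayleyToricIdeal K G)) := by
  obtain ⟨𝒢, h𝒢⟩ := exists_isReducedGroebnerBasis_monomialKernel
    (revLexOrder (restrictOrder lo)) K (fun S : StableSet G => ((rho ℤ S.1, 1) : (V → ℤ) × ℕ))
  rw [← stableToricIdeal_eq] at h𝒢
  refine ⟨⟨𝒢, fun B => ⟨fun hB => ?_, fun hB => hB ▸ h𝒢⟩,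
    hG.isGroebnerBasis_cayleyToricIdeal hlo h𝒢.toIsGroebnerBasis⟩,
    hG.isSquarefree_initialIdeal_cayleyToricIdeal hlo⟩
  exact (hB.subset_of_isReduced h𝒢).antisymm (h𝒢.subset_of_isReduced hB)
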